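/- Let $0\le a<b\le\pi$ with $[a,b]\neq[0,\pi]$, and put $\theta=\frac{b-a}{2}\in(0,\pi/2)$, $\xi=e^{i(a+\theta)}$, $\mathbb H=\{z\in\mathbb C:\operatorname{Im}z>0\}$ and $\Delta(\theta)=\dfrac1{\sqrt{4+\tan^2\theta}}$. Call real sequences $(a_k),(\gamma_k),(\epsilon_k),(\theta_k)$, $k\ge1$, admissible if, for all $k\ge 1$, $$a_k>0,\quad \gamma_k>0,\quad \epsilon_k>0,\quad \pi\epsilon_k\le\theta,\quad \lim_{j\to\infty}\epsilon_j=0,\qquad \theta_{2k}+\pi\epsilon_{2k}=\theta,\quad \theta_{2k-1}-\pi\epsilon_{2k-1}=-\theta,$$ $$\sum_{l=1}^\infty\frac{a_l}{\gamma_l^{\epsilon_l}}\le\frac{\gamma_1}{2}\ \text{ (in particular the series converges)},\qquad \gamma_1\ge2,\qquad \gamma_{k+1}>\gamma_k^2,$$ $$\sum_{l=1}^{k-1}\frac{a_l}{\gamma_k^{\epsilon_l}}\le\frac{\Delta(\theta)a_k}{2k\gamma_k^{2\epsilon_k}},\qquad \sum_{l=k+1}^{\infty}\frac{a_l}{\gamma_l^{\epsilon_l}}\le\frac{\Delta(\theta)a_k}{2k\gamma_k^{2\epsilon_k}}.$$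 Then admissible sequences exist. Moreover, for any admissible sequences, with $F(z)=z+\sum_{k=1}^\infty \dfrac{a_ke^{i\theta_k}}{(z+\gamma_k)^{\epsilon_k}}$ (principal branch of the powers), the following holds. For every $z\in\mathbb H$ the series defining $F(\overline{\xi}z)$ converges, and $f(z)=\xi F(\overline{\xi}z)$ defines a holomorphic map $f\colon\mathbb H\to\mathbb H$ such that: 1. the Denjoy–Wolff point of $f$ is $\infty$, i.e. $f^n\to\infty$ locally uniformly on $\mathbb H$, and $f$ is parabolic, i.e. $f(z)/z$ has angular limit $1$ at $\infty$ (limit as $|z|\to\infty$ in each sector $\delta<\arg z<\pi-\delta$, $\delta>0$); 2. $f$ has zero hyperbolic step: the hyperbolic distance between $f^{n+1}(z)$ and $f^n(z)$ tends to $0$ for every $z\in\mathbb H$; 3. for every $z\in\mathbb H$, the set $\mathrm{Slope}[f,z]$ of all $s\in[0,\pi]$ for which there is a subsequence of the orbit with $\arg f^{n_k}(z)\to s$ equals $[a,b]$; 4. let $z_0=\xi\gamma_1/2\in\mathbb H$, and for $k\ge1$ let $N_k$ be the least $n$ with $\operatorname{Re}(\overline{\xi}f^n(z_0))>\gamma_k^2$.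 Then each $N_k$ exists, $(N_k)_{k\ge 1}$ is strictly increasing, and $\arg f^{N_{2k}}(z_0)\to b$, $\arg f^{N_{2k+1}}(z_0)\to a$ as $k\to\infty$. -/

import Mathlib

open Filter Topology UpperHalfPlane
open scoped Real Manifold

noncomputable section

/-- Infinity is the Denjoy-Wolff point of `f : ℍ → ℍ`: the iterates of `f` converge to infinity,
uniformly on compact subsets of the upper half-plane. -/
def HasDenjoyWolffInfty (f : ℍ → ℍ) : Prop :=
  ∀ K : Set ℍ, IsCompact K → ∀ R : ℝ, ∀ᶠ n : ℕ in atTop, ∀ z ∈ K, R < ‖((f^[n] z : ℍ) : ℂ)‖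

/-- The function `g` has angular (non-tangential) limit `α` at infinity: in every sector
`{δ < arg z < π - δ}`, `δ > 0`, the values `g z` tend to `α` as `|z| → ∞`. -/
def HasAngularLimitInfty (g : ℍ → ℂ) (α : ℂ) : Prop :=
  ∀ δ : ℝ, 0 < δ →
    Tendsto g
      (comap (fun z : ℍ => ‖(z : ℂ)‖) atTop ⊓
        𝓟 {z : ℍ | δ < Complex.arg (z : ℂ) ∧ Complex.arg (z : ℂ) < π - δ})
      (𝓝 α)

/-- `f` is a parabolic holomorphic self-map of the upper half-plane with Denjoy-Wolff point
infinity: the angular limit of `f z / z` at infinity is `1`. -/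
structure IsParabolicInfty (f : ℍ → ℍ) : Prop where
  holomorphic : MDifferentiable 𝓘(ℂ) 𝓘(ℂ) f
  denjoyWolff : HasDenjoyWolffInfty f
  angular : HasAngularLimitInfty (fun z => (f z : ℂ) / (z : ℂ)) 1

/-- `f` has zero hyperbolic step; `dist` on `ℍ` is the hyperbolic distance. -/
def HasZeroHyperbolicStep (f : ℍ → ℍ) : Prop :=
  ∀ z : ℍ, Tendsto (fun n : ℕ => dist (f^[n + 1] z) (f^[n] z)) atTop (𝓝 0)

/-- The set of slopes of `f` at the starting point `z`. -/
def slopeSet (f : ℍ → ℍ) (z : ℍ) : Set ℝ :=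
  {s | s ∈ Set.Icc 0 π ∧ ∃ φ : ℕ → ℕ, StrictMono φ ∧
    Tendsto (fun k => Complex.arg ((f^[φ k] z : ℍ) : ℂ)) atTop (𝓝 s)}

/-- Four real sequences `a_k`, `γ_k`, `ε_k`, `θ_k`. Only the indices `k ≥ 1` are ever used
(the values at `0` are irrelevant). -/
structure SlopeCoeffs where
  a : ℕ → ℝ
  γ : ℕ → ℝ
  ε : ℕ → ℝ
  ϑ : ℕ → ℝ

namespace SlopeCoeffs

/-- The constant `Δ(θ) = 1 / √(4 + tan² θ)`. -/
def Δ (θ : ℝ) : ℝ := 1 / √(4 + Real.tan θ ^ 2)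

/-- The growth conditions on the coefficients relative to the angle `θ`. -/
structure Admissible (c : SlopeCoeffs) (θ : ℝ) : Prop where
  a_pos : ∀ k, 1 ≤ k → 0 < c.a k
  γ_pos : ∀ k, 1 ≤ k → 0 < c.γ k
  ε_pos : ∀ k, 1 ≤ k → 0 < c.ε k
  ε_le : ∀ k, 1 ≤ k → π * c.ε k ≤ θ
  ε_lim : Tendsto c.ε atTop (𝓝 0)
  angle_even : ∀ k, 1 ≤ k → c.ϑ (2 * k) + π * c.ε (2 * k) = θ
  angle_odd : ∀ k, 1 ≤ k → c.ϑ (2 * k - 1) - π * c.ε (2 * k - 1) = -θ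
  step_summable : Summable fun l : ℕ => c.a (l + 1) / c.γ (l + 1) ^ c.ε (l + 1)
  step : ∑' l : ℕ, c.a (l + 1) / c.γ (l + 1) ^ c.ε (l + 1) ≤ c.γ 1 / 2
  γ_one : 2 ≤ c.γ 1
  γ_growth : ∀ k, 1 ≤ k → c.γ k ^ 2 < c.γ (k + 1)
  head_le : ∀ k, 1 ≤ k →
    ∑ l ∈ Finset.Ico 1 k, c.a l / c.γ k ^ c.ε l
      ≤ Δ θ * c.a k / (2 * k * c.γ k ^ (2 * c.ε k))
  tail_le : ∀ k, 1 ≤ k →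
    ∑' l : ℕ, c.a (k + 1 + l) / c.γ (k + 1 + l) ^ c.ε (k + 1 + l)
      ≤ Δ θ * c.a k / (2 * k * c.γ k ^ (2 * c.ε k))

/-- `p_k(z) = a_k e^{iθ_k} / (z + γ_k)^{ε_k}`, with the principal branch of the power. -/
def term (c : SlopeCoeffs) (k : ℕ) (z : ℂ) : ℂ :=
  (c.a k : ℂ) * Complex.exp (Complex.I * (c.ϑ k : ℂ)) / (z + (c.γ k : ℂ)) ^ (c.ε k : ℂ)

/-- `F(z) = z + ∑_{k ≥ 1} p_k(z)`. -/
def F (c : SlopeCoeffs) (z : ℂ) : ℂ := z + ∑' k : ℕ, c.term (k + 1) z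

end SlopeCoeffs

/-- The rotation `ξ = e^{i(a + θ)}`, where `θ = (b - a) / 2`. -/
def slopeRotation (a b : ℝ) : ℂ := Complex.exp (Complex.I * ((a + (b - a) / 2 : ℝ) : ℂ))

/-- The first `n` such that the `n`-th point of the orbit of `z`, rotated back by the conjugate
of `ξ`, has real part larger than `γ_k ^ 2`. -/
def exitTime (c : SlopeCoeffs) (ξ : ℂ) (f : ℍ → ℍ) (z : ℍ) (k : ℕ) : ℕ :=
  sInf {n : ℕ | c.γ k ^ 2 < (starRingEnd ℂ ξ * ((f^[n] z : ℍ) : ℂ)).re}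

end

/-! Since $\arg(z+\gamma_k)$ ranges over an interval of length $2\pi$, the argument of the $k$-th
summand of $F(z)-z$ stays in a window of width $2\pi\epsilon_k$. The choice of $\theta_k$ places one
end of the window on the ray $\arg=\theta$ ($k$ even) or $\arg=-\theta$ ($k$ odd), and
$\pi\epsilon_k\le\theta$ keeps it inside the sector $|\arg|\le\theta$ (`exists_term_polar`). So the
displacement lies in that sector: along an orbit of $F$ the real part and both tilts are
nondecreasing. After rotation by $\xi$ this makes $\mathbb H$ invariant (`exp_mul_F_im`), sends
orbits to $\infty$ (`exists_forall_lt_re`) and confines slopes asymptotically to $[-\theta,\theta]$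
(`abs_slope_le`).

While the real part runs from $\gamma_k$ to $\gamma_k^2$, the head and tail conditions make the
$k$-th summand dominate, so the orbit moves almost parallel to its boundary ray
(`tilt_displacement_le`). It enters this range with tilt $O(\gamma_k)$ and leaves it with real part
above $\gamma_k^2$, so its slope at the exit is within $O(1/\gamma_k+\epsilon_k+1/k)$ of
$\pm\tan\theta$ (`exists_slope_error`). Both endpoints are therefore slopes; the displacement tends
to $0$, so successive slopes approach each other and all values between are attained as limits
(`slopeSet_eq`). Vanishing displacement together with nondecreasing imaginary part also gives zero
hyperbolic step. -/

/-- The signed distance from `v` to the ray `arg = s θ`, for `s = ± 1`. -/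
noncomputable def tilt (θ s : ℝ) (v : ℂ) : ℝ := Real.sin θ * v.re - s * (Real.cos θ * v.im)

lemma tilt_add (θ s : ℝ) (v w : ℂ) : tilt θ s (v + w) = tilt θ s v + tilt θ s w := by
  simp only [tilt, Complex.add_re, Complex.add_im]; ring

/-- The defect $\|v\|^2-\mathrm{tilt}^2$ is the square of the component of $v$ along the ray. -/
lemma tilt_le_norm {s : ℝ} (hs : s ^ 2 = 1) (θ : ℝ) (v : ℂ) : tilt θ s v ≤ ‖v‖ := by
  have h : ‖v‖ ^ 2 = v.re ^ 2 + v.im ^ 2 := by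
    rw [Complex.sq_norm, Complex.normSq_apply]; ring
  refine le_of_sq_le_sq ?_ (norm_nonneg v)
  have := Real.sin_sq_add_cos_sq θ
  have h2 : ‖v‖ ^ 2 - tilt θ s v ^ 2 = (Real.cos θ * v.re + s * (Real.sin θ * v.im)) ^ 2 := by
    rw [h, tilt]
    linear_combination (-(v.re ^ 2) - v.im ^ 2) * this +
      (- Real.cos θ ^ 2 * v.im ^ 2 - Real.sin θ ^ 2 * v.im ^ 2) * hs
  nlinarith [sq_nonneg (Real.cos θ * v.re + s * (Real.sin θ * v.im))]

lemma hasSum_tilt {f : ℕ → ℂ} {v : ℂ} (h : HasSum f v) (θ s : ℝ) :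
    HasSum (fun n => tilt θ s (f n)) (tilt θ s v) := by
  obtain ⟨hr, hi⟩ := (Complex.hasSum_iff _ _).1 h
  exact (hr.mul_left _).sub ((hi.mul_left _).mul_left _)

/-! ### Direction and size of the summands and of the displacement. -/

namespace SlopeCoeffs

/-- The side of the sector towards which the `k`-th summand points. -/
def side (k : ℕ) : ℝ := if Even k then 1 else -1

lemma side_sq (k : ℕ) : side k ^ 2 = 1 := by
  unfold side; split_ifs <;> norm_num

lemma side_eq (k : ℕ) : side k = 1 ∨ side k = -1 := by
  unfold side; split_ifs <;> simp

/-- The displacement `F(z) - z`. -/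
noncomputable def displacement (c : SlopeCoeffs) (z : ℂ) : ℂ := ∑' k : ℕ, c.term (k + 1) z

lemma F_eq (c : SlopeCoeffs) (z : ℂ) : c.F z = z + c.displacement z := rfl

lemma norm_term (c : SlopeCoeffs) {k : ℕ} (ha : 0 < c.a k) (w : ℂ) :
    ‖c.term k w‖ = c.a k / ‖w + c.γ k‖ ^ c.ε k := by
  simp only [term, norm_div, norm_mul, Complex.norm_exp_I_mul_ofReal, Complex.norm_cpow_real,
    Complex.norm_real, Real.norm_eq_abs, abs_of_pos ha, mul_one]

lemma term_eq_polar (c : SlopeCoeffs) {k : ℕ} (ha : 0 < c.a k) {w : ℂ} (hw : w + c.γ k ≠ 0) :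
    c.term k w = (‖c.term k w‖ : ℂ) *
      Complex.exp ((c.ϑ k - c.ε k * Complex.arg (w + c.γ k) : ℝ) * Complex.I) := by
  have hn : 0 < ‖w + c.γ k‖ := norm_pos_iff.2 hw
  rw [norm_term c ha, Real.rpow_def_of_pos hn, term, Complex.cpow_def_of_ne_zero hw]
  push_cast
  rw [div_eq_mul_inv, div_eq_mul_inv, ← Complex.exp_neg, ← Complex.exp_neg, mul_assoc, mul_assoc,
    ← Complex.exp_add, ← Complex.exp_add]
  congr 2
  rw [Complex.log]
  ring_nf

namespace Admissible

variable {c : SlopeCoeffs} {θ : ℝ}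

lemma angle (h : c.Admissible θ) {k : ℕ} (hk : 1 ≤ k) : c.ϑ k = side k * (θ - π * c.ε k) := by
  rcases Nat.even_or_odd' k with ⟨j, rfl | rfl⟩
  · have := h.angle_even j (by omega)
    rw [side, if_pos (by simp)]; linarith
  · have := h.angle_odd (j + 1) (by omega)
    rw [show 2 * (j + 1) - 1 = 2 * j + 1 by omega] at this
    rw [side, if_neg (by simp)]; linarith

lemma ε_lt_one (h : c.Admissible θ) (hθ : θ < π / 2) {k : ℕ} (hk : 1 ≤ k) : c.ε k < 1 := by
  have := h.ε_le k hk
  nlinarith [Real.pi_pos]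

/-- Here $\tau=\epsilon_k(\pi\pm\arg(w+\gamma_k))$ is the angle by which the summand deviates from
its boundary ray, turning inwards. -/
lemma exists_term_polar (h : c.Admissible θ) {k : ℕ} (hk : 1 ≤ k) {w : ℂ} (hw : w + c.γ k ≠ 0) :
    ∃ τ, 0 ≤ τ ∧ τ ≤ 2 * π * c.ε k ∧
      (c.term k w).re = ‖c.term k w‖ * Real.cos (θ - τ) ∧
      (c.term k w).im = ‖c.term k w‖ * (side k * Real.sin (θ - τ)) := by
  set α := Complex.arg (w + c.γ k) with hα
  have h1 := Complex.arg_le_pi (w + c.γ k)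
  have h2 := Complex.neg_pi_lt_arg (w + c.γ k)
  have he := h.ε_pos k hk
  have hp := term_eq_polar c (h.a_pos k hk) hw
  have hre := congrArg Complex.re hp
  have him := congrArg Complex.im hp
  rw [Complex.re_ofReal_mul, Complex.exp_ofReal_mul_I_re, ← hα] at hre
  rw [Complex.im_ofReal_mul, Complex.exp_ofReal_mul_I_im, ← hα] at him
  rw [h.angle hk] at hre him
  rcases side_eq k with hs | hs
  · refine ⟨c.ε k * (π + α), by nlinarith, by nlinarith, ?_, ?_⟩
    · rw [hre, hs]; congr 2; ring
    · rw [him, hs, one_mul]; congr 2; ring_nf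
  · refine ⟨c.ε k * (π - α), by nlinarith, by nlinarith, ?_, ?_⟩
    · rw [hre, hs, ← Real.cos_neg]; congr 2; ring
    · rw [him, hs, neg_one_mul, neg_one_mul, ← Real.sin_neg]; congr 2; ring

lemma cos_le_term_re (h : c.Admissible θ) (hθ : θ < π / 2) {k : ℕ} (hk : 1 ≤ k)
    {w : ℂ} (hw : w + c.γ k ≠ 0) : ‖c.term k w‖ * Real.cos θ ≤ (c.term k w).re := by
  obtain ⟨τ, h0, h1, hre, -⟩ := h.exists_term_polar hk hw
  have he := h.ε_le k hk
  have he' := h.ε_pos k hk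
  have hp := Real.pi_pos
  rw [hre]
  refine mul_le_mul_of_nonneg_left ?_ (norm_nonneg _)
  rw [← Real.cos_abs (θ - τ)]
  refine Real.cos_le_cos_of_nonneg_of_le_pi (abs_nonneg _) (by nlinarith) ?_
  rw [abs_le]
  constructor <;> nlinarith

lemma tilt_term_nonneg (h : c.Admissible θ) (hθ : θ < π / 2) {k : ℕ} (hk : 1 ≤ k)
    {w : ℂ} (hw : w + c.γ k ≠ 0) {s : ℝ} (hs : s ^ 2 = 1) : 0 ≤ tilt θ s (c.term k w) := by
  obtain ⟨τ, h0, h1, hre, him⟩ := h.exists_term_polar hk hw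
  have he := h.ε_le k hk
  have hp := Real.pi_pos
  -- The two signs give $\sin\tau$ and $\sin(2\theta-\tau)$; both arguments lie in
  -- $[0,2\theta]\subset[0,\pi]$.
  have key : ∀ u : ℝ, u ^ 2 = 1 →
      0 ≤ Real.sin θ * Real.cos (θ - τ) - u * (Real.cos θ * Real.sin (θ - τ)) := by
    intro u hu
    rcases eq_or_eq_neg_of_sq_eq_sq u 1 (by rw [hu, one_pow]) with rfl | rfl
    · rw [one_mul, ← Real.sin_sub]
      exact Real.sin_nonneg_of_nonneg_of_le_pi (by linarith) (by linarith)
    · rw [neg_one_mul, sub_neg_eq_add, ← Real.sin_add]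
      exact Real.sin_nonneg_of_nonneg_of_le_pi (by linarith) (by linarith)
  have := mul_nonneg (norm_nonneg (c.term k w)) (key (s * side k) (by
    rw [mul_pow, hs, side_sq, one_mul]))
  rw [tilt, hre, him]
  linarith

lemma tilt_term_le (h : c.Admissible θ) {k : ℕ} (hk : 1 ≤ k)
    {w : ℂ} (hw : w + c.γ k ≠ 0) :
    tilt θ (side k) (c.term k w) ≤ ‖c.term k w‖ * (2 * π * c.ε k) := by
  obtain ⟨τ, h0, h1, hre, him⟩ := h.exists_term_polar hk hw
  have : tilt θ (side k) (c.term k w) = ‖c.term k w‖ * Real.sin τ := by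
    have hsin : Real.sin τ = Real.sin (θ - (θ - τ)) := by congr 1; ring
    rw [hsin, Real.sin_sub, tilt, hre, him]
    linear_combination (- ‖c.term k w‖ * Real.cos θ * Real.sin (θ - τ)) * side_sq k
  rw [this]
  exact mul_le_mul_of_nonneg_left ((Real.sin_le h0).trans h1) (norm_nonneg _)

/-- As $\epsilon_k<1$ and $m\le1$, one has $m\le m^{\epsilon_k}$. The constant is thus independent
of $k$, and the admissibility series is a majorant. -/
lemma norm_term_le (h : c.Admissible θ) (hθ : θ < π / 2) {k : ℕ} (hk : 1 ≤ k) {m : ℝ}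
    (hm : 0 < m) (hm1 : m ≤ 1) {w : ℂ} (hw : m * c.γ k ≤ ‖w + c.γ k‖) :
    ‖c.term k w‖ ≤ m⁻¹ * (c.a k / c.γ k ^ c.ε k) := by
  have hγ := h.γ_pos k hk
  have ha := h.a_pos k hk
  have he := h.ε_pos k hk
  have h1 : m ≤ m ^ c.ε k := by
    conv_lhs => rw [← Real.rpow_one m]
    exact Real.rpow_le_rpow_of_exponent_ge hm hm1 (h.ε_lt_one hθ hk).le
  have hp : 0 < c.γ k ^ c.ε k := Real.rpow_pos_of_pos hγ _
  have h2 : m * c.γ k ^ c.ε k ≤ ‖w + c.γ k‖ ^ c.ε k := by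
    calc m * c.γ k ^ c.ε k ≤ m ^ c.ε k * c.γ k ^ c.ε k := by gcongr
      _ = (m * c.γ k) ^ c.ε k := (Real.mul_rpow hm.le hγ.le).symm
      _ ≤ _ := Real.rpow_le_rpow (by positivity) hw he.le
  rw [norm_term c ha]
  calc c.a k / ‖w + c.γ k‖ ^ c.ε k ≤ c.a k / (m * c.γ k ^ c.ε k) := by gcongr
    _ = _ := by field_simp

/-- The points `w` at which the series for the displacement is dominated by `m⁻¹` times its
value at `0`. -/
def _root_.SlopeCoeffs.Dominated (c : SlopeCoeffs) (m : ℝ) (w : ℂ) : Prop :=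
  0 < m ∧ m ≤ 1 ∧ ∀ k, 1 ≤ k → m * c.γ k ≤ ‖w + c.γ k‖

lemma add_ne_zero (h : c.Admissible θ) {m : ℝ} {w : ℂ} (hw : c.Dominated m w) {k : ℕ}
    (hk : 1 ≤ k) : w + c.γ k ≠ 0 := by
  have := h.γ_pos k hk
  exact norm_pos_iff.1 ((mul_pos hw.1 this).trans_le (hw.2.2 k hk))

lemma dominated_one {w : ℂ} (hw : 0 ≤ w.re) : c.Dominated 1 w := by
  refine ⟨one_pos, le_rfl, fun k hk => ?_⟩
  have := Complex.re_le_norm (w + c.γ k)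
  simp only [Complex.add_re, Complex.ofReal_re] at this
  linarith

lemma summable_norm_term (h : c.Admissible θ) (hθ : θ < π / 2) {m : ℝ} {w : ℂ}
    (hw : c.Dominated m w) : Summable fun k : ℕ => ‖c.term (k + 1) w‖ :=
  Summable.of_nonneg_of_le (fun _ => norm_nonneg _)
    (fun k => h.norm_term_le hθ k.succ_pos hw.1 hw.2.1 (hw.2.2 _ k.succ_pos))
    (h.step_summable.mul_left _)

lemma summable_term (h : c.Admissible θ) (hθ : θ < π / 2) {m : ℝ} {w : ℂ}
    (hw : c.Dominated m w) : Summable fun k : ℕ => c.term (k + 1) w :=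
  (h.summable_norm_term hθ hw).of_norm

lemma hasSum_displacement (h : c.Admissible θ) (hθ : θ < π / 2) {m : ℝ} {w : ℂ}
    (hw : c.Dominated m w) : HasSum (fun k : ℕ => c.term (k + 1) w) (c.displacement w) :=
  (h.summable_term hθ hw).hasSum

lemma norm_displacement_le (h : c.Admissible θ) (hθ : θ < π / 2) {m : ℝ} {w : ℂ}
    (hw : c.Dominated m w) : ‖c.displacement w‖ ≤ m⁻¹ * (c.γ 1 / 2) := by
  refine (tsum_of_norm_bounded (h.step_summable.hasSum.mul_left m⁻¹) fun k =>
    h.norm_term_le hθ k.succ_pos hw.1 hw.2.1 (hw.2.2 _ k.succ_pos)).trans ?_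
  exact mul_le_mul_of_nonneg_left h.step (inv_nonneg.2 hw.1.le)

/-- All summands have nonnegative real part, so a single one bounds the total from below. -/
lemma norm_term_mul_cos_le_displacement_re (h : c.Admissible θ) (h0 : 0 < θ) (hθ : θ < π / 2)
    {m : ℝ} {w : ℂ} (hw : c.Dominated m w) {k : ℕ} (hk : 1 ≤ k) :
    ‖c.term k w‖ * Real.cos θ ≤ (c.displacement w).re := by
  have hc : 0 < Real.cos θ := Real.cos_pos_of_mem_Ioo ⟨by linarith, hθ⟩
  obtain ⟨j, rfl⟩ : ∃ j, k = j + 1 := ⟨k - 1, by omega⟩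
  have hs := ((Complex.hasSum_iff _ _).1 (h.hasSum_displacement hθ hw)).1
  have hle := fun i : ℕ => h.cos_le_term_re hθ i.succ_pos (h.add_ne_zero hw i.succ_pos)
  refine (hle j).trans (le_hasSum hs j fun i _ => ?_)
  exact le_trans (by positivity) (hle i)

lemma tilt_displacement_nonneg (h : c.Admissible θ) (hθ : θ < π / 2)
    {m : ℝ} {w : ℂ} (hw : c.Dominated m w) {s : ℝ} (hs : s ^ 2 = 1) :
    0 ≤ tilt θ s (c.displacement w) :=
  (hasSum_tilt (h.hasSum_displacement hθ hw) θ s).nonneg fun i =>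
    h.tilt_term_nonneg hθ i.succ_pos (h.add_ne_zero hw i.succ_pos) hs

lemma displacement_re_nonneg (h : c.Admissible θ) (h0 : 0 < θ) (hθ : θ < π / 2)
    {m : ℝ} {w : ℂ} (hw : c.Dominated m w) : 0 ≤ (c.displacement w).re := by
  have hc : 0 < Real.cos θ := Real.cos_pos_of_mem_Ioo ⟨by linarith, hθ⟩
  exact le_trans (by positivity) (h.norm_term_mul_cos_le_displacement_re h0 hθ hw le_rfl)

lemma norm_term_le_div (h : c.Admissible θ) {k : ℕ} (hk : 1 ≤ k) {R : ℝ} (hR : 0 < R) {w : ℂ}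
    (hw : R ≤ ‖w + c.γ k‖) : ‖c.term k w‖ ≤ c.a k / R ^ c.ε k := by
  have ha := h.a_pos k hk
  rw [norm_term c ha]
  gcongr
  exact (h.ε_pos k hk).le

lemma re_le_norm_add (h : c.Admissible θ) {w : ℂ} {k : ℕ} (hk : 1 ≤ k) :
    w.re ≤ ‖w + c.γ k‖ := by
  have := Complex.re_le_norm (w + c.γ k)
  simp only [Complex.add_re, Complex.ofReal_re] at this
  linarith [h.γ_pos k hk]

/-- For $l<k$ use $|w+\gamma_l|\ge\gamma_k$, for $l>k$ use $|w+\gamma_l|\ge\gamma_l$: these are the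
denominators in `head_le` and `tail_le`, and each part costs one copy of the admissible bound. -/
lemma tilt_displacement_le_add (h : c.Admissible θ) (hθ : θ < π / 2)
    {k : ℕ} (hk : 1 ≤ k) {w : ℂ} (hw : c.γ k ≤ w.re) :
    tilt θ (side k) (c.displacement w) ≤ ‖c.term k w‖ * (2 * π * c.ε k) +
      2 * (Δ θ * c.a k / (2 * k * c.γ k ^ (2 * c.ε k))) := by
  have hγk := h.γ_pos k hk
  have hw0 : 0 ≤ w.re := hγk.le.trans hw
  have hdom := dominated_one (c := c) hw0
  have hhead := h.head_le k hk
  have htail := h.tail_le k hk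
  have hmain := h.tilt_term_le hk (h.add_ne_zero hdom hk)
  have hs2 := side_sq k
  generalize side k = s at *
  have hsum := hasSum_tilt (h.hasSum_displacement hθ hdom) θ s
  generalize Δ θ * c.a k / (2 * k * c.γ k ^ (2 * c.ε k)) = E at *
  obtain ⟨j, rfl⟩ : ∃ j, k = j + 1 := ⟨k - 1, by omega⟩
  have hsplit := hsum.summable.sum_add_tsum_nat_add (j + 1)
  rw [hsum.tsum_eq, Finset.sum_range_succ] at hsplit
  have hhead' : ∑ i ∈ Finset.range j, tilt θ s (c.term (i + 1) w) ≤ E := by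
    rw [Finset.sum_Ico_eq_sum_range] at hhead
    refine le_trans (Finset.sum_le_sum fun i _ => ?_) hhead
    refine (tilt_le_norm hs2 θ _).trans ?_
    rw [add_comm i 1]
    exact h.norm_term_le_div (by omega) hγk (hw.trans (h.re_le_norm_add (by omega)))
  have htail' : ∑' i, tilt θ s (c.term (i + (j + 1) + 1) w) ≤ E := by
    have hsm : Summable fun l : ℕ => c.a (j + 1 + 1 + l) / c.γ (j + 1 + 1 + l) ^
        c.ε (j + 1 + 1 + l) := by
      refine ((summable_nat_add_iff
        (f := fun l => c.a (l + 1) / c.γ (l + 1) ^ c.ε (l + 1)) (j + 1)).2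
          h.step_summable).congr fun l => ?_
      rw [show l + (j + 1) + 1 = j + 1 + 1 + l by ring]
    have hsm' : Summable fun l : ℕ => tilt θ s (c.term (l + (j + 1) + 1) w) :=
      (summable_nat_add_iff (f := fun l => tilt θ s (c.term (l + 1) w)) (j + 1)).2 hsum.summable
    refine le_trans (hsm'.tsum_le_tsum (fun i => ?_) hsm) htail
    refine (tilt_le_norm hs2 θ _).trans ?_
    rw [show i + (j + 1) + 1 = j + 1 + 1 + i by ring]
    have := hdom.2.2 (j + 1 + 1 + i) (by omega)
    rw [one_mul] at this
    exact h.norm_term_le_div (by omega) (h.γ_pos _ (by omega)) this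
  linarith

lemma Δ_le_one (θ : ℝ) : Δ θ ≤ 1 := by
  rw [Δ, div_le_one (by positivity), Real.one_le_sqrt]
  nlinarith [sq_nonneg (Real.tan θ)]

/-- Up to $|w|\approx\gamma_k^2$ the $k$-th summand is still comparable to
$a_k/\gamma_k^{2\epsilon_k}$, the quantity against which the other summands are measured. -/
lemma div_rpow_le_norm_term (h : c.Admissible θ) (hθ : θ < π / 2)
    {k : ℕ} (hk : 1 ≤ k) {C : ℝ} (hC : 1 ≤ C) {w : ℂ} (hw : w + c.γ k ≠ 0)
    (hw' : ‖w + c.γ k‖ ≤ C * c.γ k ^ 2) :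
    c.a k / c.γ k ^ (2 * c.ε k) ≤ C * ‖c.term k w‖ := by
  have ha := h.a_pos k hk
  have he := h.ε_pos k hk
  have hγk := h.γ_pos k hk
  have hne := norm_pos_iff.2 hw
  rw [norm_term c ha]
  have h1 : ‖w + c.γ k‖ ^ c.ε k ≤ C * c.γ k ^ (2 * c.ε k) := by
    calc ‖w + c.γ k‖ ^ c.ε k ≤ (C * c.γ k ^ 2) ^ c.ε k :=
          Real.rpow_le_rpow hne.le hw' he.le
      _ = C ^ c.ε k * c.γ k ^ (2 * c.ε k) := by
          rw [Real.mul_rpow (by linarith) (by positivity), Real.rpow_mul hγk.le]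
          norm_num
      _ ≤ C * c.γ k ^ (2 * c.ε k) := by
          gcongr
          conv_rhs => rw [← Real.rpow_one C]
          exact Real.rpow_le_rpow_of_exponent_le hC (h.ε_lt_one hθ hk).le
  have hp : 0 < c.γ k ^ (2 * c.ε k) := Real.rpow_pos_of_pos hγk _
  have hp' : 0 < ‖w + c.γ k‖ ^ c.ε k := Real.rpow_pos_of_pos hne _
  rw [← mul_div_assoc, div_le_div_iff₀ hp hp']
  have := mul_le_mul_of_nonneg_left h1 ha.le
  linarith

/-- While `γ_k ≤ Re w` and `w` is not much larger than `γ_k ^ 2`, the `k`-th summand dominates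
the displacement, which therefore is almost parallel to the ray `arg = ± θ`. -/
lemma tilt_displacement_le (h : c.Admissible θ) (h0 : 0 < θ) (hθ : θ < π / 2)
    {k : ℕ} (hk : 1 ≤ k) {C : ℝ} (hC : 1 ≤ C) {w : ℂ}
    (hw : c.γ k ≤ w.re) (hw' : ‖w + c.γ k‖ ≤ C * c.γ k ^ 2) :
    tilt θ (side k) (c.displacement w) ≤
      (2 * π * c.ε k + C / k) / Real.cos θ * (c.displacement w).re := by
  have hcos : 0 < Real.cos θ := Real.cos_pos_of_mem_Ioo ⟨by linarith, hθ⟩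
  have hdom := dominated_one (c := c) ((h.γ_pos k hk).le.trans hw)
  have hre := h.norm_term_mul_cos_le_displacement_re h0 hθ hdom hk
  have hk0 : (0 : ℝ) < k := by exact_mod_cast hk
  have hlow := h.div_rpow_le_norm_term hθ hk hC (h.add_ne_zero hdom hk) hw'
  have hadd := h.tilt_displacement_le_add hθ hk hw
  have he := h.ε_pos k hk
  have hpi := Real.pi_pos
  have ha := h.a_pos k hk
  have hp : 0 < c.γ k ^ (2 * c.ε k) := Real.rpow_pos_of_pos (h.γ_pos k hk) _
  -- Only $\Delta(\theta)\le1$ is needed; the gain is the factor $1/k$.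
  have hE : 2 * (Δ θ * c.a k / (2 * k * c.γ k ^ (2 * c.ε k))) ≤ C * ‖c.term k w‖ / k := by
    calc 2 * (Δ θ * c.a k / (2 * k * c.γ k ^ (2 * c.ε k)))
        = Δ θ * (c.a k / c.γ k ^ (2 * c.ε k) / k) := by field_simp
      _ ≤ 1 * (c.a k / c.γ k ^ (2 * c.ε k) / k) := by
        gcongr
        exact Δ_le_one θ
      _ ≤ _ := by rw [one_mul]; gcongr
  have hη : 0 ≤ (2 * π * c.ε k + C / k) / Real.cos θ := by positivity
  refine le_trans (hadd.trans ?_) (mul_le_mul_of_nonneg_left hre hη)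
  have heq : (2 * π * c.ε k + C / k) / Real.cos θ * (‖c.term k w‖ * Real.cos θ) =
      ‖c.term k w‖ * (2 * π * c.ε k) + C * ‖c.term k w‖ / k := by
    field_simp
  rw [heq]
  linarith

end Admissible

end SlopeCoeffs

/-! ### Orbits of $F$: escape to infinity and control of the slope. -/

lemma neg_norm_le_tilt {s : ℝ} (hs : s ^ 2 = 1) (θ : ℝ) (v : ℂ) : -‖v‖ ≤ tilt θ s v := by
  have h := tilt_le_norm hs θ (-v)
  simp only [tilt, norm_neg, Complex.neg_re, Complex.neg_im] at h ⊢
  linarith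

lemma abs_im_mul_cos_le {θ : ℝ} {v : ℂ} (h1 : 0 ≤ tilt θ 1 v) (h2 : 0 ≤ tilt θ (-1) v) :
    |Real.cos θ * v.im| ≤ Real.sin θ * v.re := by
  simp only [tilt] at h1 h2
  rw [abs_le]
  constructor <;> linarith

lemma norm_mul_cos_le_re {θ : ℝ} (h0 : 0 < θ) (hθ : θ < π / 2) {v : ℂ}
    (h1 : 0 ≤ tilt θ 1 v) (h2 : 0 ≤ tilt θ (-1) v) : ‖v‖ * Real.cos θ ≤ v.re := by
  have h := abs_im_mul_cos_le h1 h2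
  have hs : 0 < Real.sin θ := Real.sin_pos_of_pos_of_lt_pi h0 (by linarith [Real.pi_pos])
  have hre : 0 ≤ v.re := by
    have := (abs_nonneg _).trans h
    exact nonneg_of_mul_nonneg_right this hs
  refine le_of_sq_le_sq ?_ hre
  have hv : ‖v‖ ^ 2 = v.re ^ 2 + v.im ^ 2 := by
    rw [Complex.sq_norm, Complex.normSq_apply]; ring
  have hsq := pow_le_pow_left₀ (abs_nonneg _) h 2
  rw [sq_abs] at hsq
  have := Real.sin_sq_add_cos_sq θ
  rw [mul_pow, hv]
  nlinarith

namespace SlopeCoeffs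

/-- `w` is an orbit of `F` along which the defining series is uniformly dominated. -/
structure IsOrbit (c : SlopeCoeffs) (m : ℝ) (w : ℕ → ℂ) : Prop where
  dominated : ∀ n, c.Dominated m (w n)
  step : ∀ n, w (n + 1) = w n + c.displacement (w n)

namespace Admissible

variable {c : SlopeCoeffs} {θ m : ℝ} {w : ℕ → ℂ}

lemma two_le_γ (h : c.Admissible θ) {k : ℕ} (hk : 1 ≤ k) : 2 ≤ c.γ k := by
  induction k, hk using Nat.le_induction with
  | base => exact h.γ_one
  | succ k hk ih => nlinarith [h.γ_growth k hk]

lemma le_γ (h : c.Admissible θ) {k : ℕ} (hk : 1 ≤ k) : (k : ℝ) ≤ c.γ k := by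
  induction k, hk using Nat.le_induction with
  | base => simpa using one_le_two.trans h.γ_one
  | succ k hk ih =>
    push_cast
    nlinarith [h.γ_growth k hk, h.two_le_γ hk]

lemma tendsto_γ (h : c.Admissible θ) : Tendsto c.γ atTop atTop :=
  tendsto_atTop_mono' _ ((eventually_ge_atTop 1).mono fun _ hk => h.le_γ hk)
    tendsto_natCast_atTop_atTop

lemma monotone_tilt (h : c.Admissible θ) (hθ : θ < π / 2) (hw : c.IsOrbit m w) {s : ℝ}
    (hs : s ^ 2 = 1) : Monotone fun n => tilt θ s (w n) :=
  monotone_nat_of_le_succ fun n => by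
    rw [hw.step, tilt_add]
    linarith [h.tilt_displacement_nonneg hθ (hw.dominated n) hs]

lemma monotone_re (h : c.Admissible θ) (h0 : 0 < θ) (hθ : θ < π / 2) (hw : c.IsOrbit m w) :
    Monotone fun n => (w n).re :=
  monotone_nat_of_le_succ fun n => by
    rw [hw.step, Complex.add_re]
    linarith [h.displacement_re_nonneg h0 hθ (hw.dominated n)]

/-- Both tilts of `w n - w 0` are nonnegative, so this vector lies in the sector, where
$\|v\|\cos\theta\le\operatorname{Re}v$. -/
lemma norm_orbit_le (h : c.Admissible θ) (h0 : 0 < θ) (hθ : θ < π / 2) (hw : c.IsOrbit m w)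
    (n : ℕ) : ‖w n‖ ≤ ‖w 0‖ + ((w n).re + ‖w 0‖) / Real.cos θ := by
  have hcos : 0 < Real.cos θ := Real.cos_pos_of_mem_Ioo ⟨by linarith, hθ⟩
  have key : ∀ s : ℝ, s ^ 2 = 1 → 0 ≤ tilt θ s (w n - w 0) := fun s hs => by
    have := h.monotone_tilt hθ hw hs n.zero_le
    simp only [tilt, Complex.sub_re, Complex.sub_im] at this ⊢
    linarith
  have := norm_mul_cos_le_re h0 hθ (key 1 (by norm_num)) (key (-1) (by norm_num))
  have h1 : ‖w n - w 0‖ ≤ ((w n).re + ‖w 0‖) / Real.cos θ := by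
    rw [le_div_iff₀ hcos]
    refine this.trans ?_
    rw [Complex.sub_re]
    linarith [(abs_le.1 (Complex.abs_re_le_norm (w 0))).1]
  have h2 := norm_le_norm_add_norm_sub' (w n) (w 0)
  linarith

/-- Orbits starting in a bounded set tend to infinity uniformly. -/
lemma exists_forall_lt_re (h : c.Admissible θ) (h0 : 0 < θ) (hθ : θ < π / 2) (M R : ℝ) :
    ∃ N : ℕ, ∀ (m : ℝ) (w : ℕ → ℂ), c.IsOrbit m w → ‖w 0‖ ≤ M → ∀ n, N ≤ n → R < (w n).re := by
  have hcos : 0 < Real.cos θ := Real.cos_pos_of_mem_Ioo ⟨by linarith, hθ⟩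
  have ha := h.a_pos 1 le_rfl
  have hγ := h.γ_pos 1 le_rfl
  set R' := |M| + (|R| + |M|) / Real.cos θ with hR'
  have hR'0 : 0 ≤ R' := by positivity
  -- While the real part is at most $|R|$ the orbit stays in the ball of radius `R'`, where the
  -- first summand alone advances the real part by at least `δ`.
  set δ := c.a 1 / (R' + c.γ 1) ^ c.ε 1 * Real.cos θ with hδ
  have hpow : 0 < (R' + c.γ 1) ^ c.ε 1 := Real.rpow_pos_of_pos (by linarith) _
  have hδ0 : 0 < δ := by positivity
  obtain ⟨N, hN⟩ := exists_nat_gt ((|R| + |M|) / δ)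
  refine ⟨N, fun m w hw hM n hn => ?_⟩
  have hM' : ‖w 0‖ ≤ |M| := hM.trans (le_abs_self M)
  by_contra! hcon
  have hmono := h.monotone_re h0 hθ hw
  have hstep : ∀ j, j ≤ n → -|M| + j * δ ≤ (w j).re := by
    intro j
    induction j with
    | zero =>
      intro _
      have := (abs_le.1 (Complex.abs_re_le_norm (w 0))).1
      simp only [Nat.cast_zero, zero_mul, add_zero]
      linarith
    | succ j ih =>
      intro hj
      have hjR : (w j).re ≤ |R| := ((hmono (by omega : j ≤ n)).trans hcon).trans (le_abs_self R)
      have hnorm : ‖w j‖ ≤ R' := by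
        refine (h.norm_orbit_le h0 hθ hw j).trans ?_
        rw [hR']
        gcongr
      have hdisp := h.norm_term_mul_cos_le_displacement_re h0 hθ (hw.dominated j) le_rfl
      have hterm : δ ≤ ‖c.term 1 (w j)‖ * Real.cos θ := by
        rw [hδ, norm_term c ha]
        have hne := norm_pos_iff.2 (h.add_ne_zero (hw.dominated j) le_rfl)
        have hle : ‖w j + c.γ 1‖ ≤ R' + c.γ 1 := by
          refine (norm_add_le _ _).trans ?_
          rw [Complex.norm_real, Real.norm_of_nonneg hγ.le]
          linarith
        have : ‖w j + c.γ 1‖ ^ c.ε 1 ≤ (R' + c.γ 1) ^ c.ε 1 :=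
          Real.rpow_le_rpow hne.le hle (h.ε_pos 1 le_rfl).le
        have hp : 0 < ‖w j + c.γ 1‖ ^ c.ε 1 := Real.rpow_pos_of_pos hne _
        gcongr
      rw [hw.step, Complex.add_re]
      push_cast
      linarith [ih (by omega)]
  have h1 := hstep n le_rfl
  rw [div_lt_iff₀ hδ0] at hN
  have h2 : (N : ℝ) * δ ≤ n * δ := by gcongr
  linarith [le_abs_self R]

lemma tendsto_re (h : c.Admissible θ) (h0 : 0 < θ) (hθ : θ < π / 2) (hw : c.IsOrbit m w) :
    Tendsto (fun n => (w n).re) atTop atTop := by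
  refine tendsto_atTop.2 fun R => ?_
  obtain ⟨N, hN⟩ := h.exists_forall_lt_re h0 hθ ‖w 0‖ R
  exact (eventually_ge_atTop N).mono fun n hn => (hN m w hw le_rfl n hn).le

/-- Dominated convergence: each summand tends to $0$ because the real part tends to infinity and
$\epsilon_k>0$. -/
lemma tendsto_displacement (h : c.Admissible θ) (h0 : 0 < θ) (hθ : θ < π / 2)
    (hw : c.IsOrbit m w) : Tendsto (fun n => c.displacement (w n)) atTop (𝓝 0) := by
  have hm := (hw.dominated 0).1
  have hm1 := (hw.dominated 0).2.1
  have := tendsto_tsum_of_dominated_convergence (𝓕 := atTop)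
    (f := fun n k => c.term (k + 1) (w n)) (g := fun _ => 0)
    (h.step_summable.mul_left m⁻¹) (fun k => ?_) (Eventually.of_forall fun n k =>
      h.norm_term_le hθ k.succ_pos hm hm1 ((hw.dominated n).2.2 _ k.succ_pos))
  · simpa [displacement] using this
  · rw [tendsto_zero_iff_norm_tendsto_zero]
    simp only [norm_term c (h.a_pos (k + 1) k.succ_pos)]
    refine Tendsto.div_atTop tendsto_const_nhds ?_
    refine (tendsto_rpow_atTop (h.ε_pos (k + 1) k.succ_pos)).comp ?_
    exact tendsto_atTop_mono (fun n => h.re_le_norm_add k.succ_pos) (h.tendsto_re h0 hθ hw)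

/-- The bound has the form $B\gamma_k+\eta(\operatorname{Re}w+\|w_0\|)$, and it propagates because
increments of the tilt are charged to increments of the real part. It is stated at `n + 1` under a
hypothesis at `n` so as to include the first exit point. -/
lemma tilt_orbit_succ_le (h : c.Admissible θ) (h0 : 0 < θ) (hθ : θ < π / 2)
    (hw : c.IsOrbit m w) {k : ℕ} (hk : 1 ≤ k) (n : ℕ) (hn : (w n).re ≤ c.γ k ^ 2) :
    tilt θ (side k) (w (n + 1)) ≤
      (‖w 0‖ + m⁻¹ * (c.γ 1 / 2) + (1 + ‖w 0‖) / Real.cos θ) * c.γ k +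
      (2 * π * c.ε k + (1 + ‖w 0‖ + (1 + ‖w 0‖) / Real.cos θ) / k) / Real.cos θ *
        ((w (n + 1)).re + ‖w 0‖) := by
  have hcos : 0 < Real.cos θ := Real.cos_pos_of_mem_Ioo ⟨by linarith, hθ⟩
  have hm := (hw.dominated 0).1
  have hγ1 := h.γ_pos 1 le_rfl
  have hγk := h.two_le_γ hk
  have hε := h.ε_pos k hk
  have hpi := Real.pi_pos
  have hmono := h.monotone_re h0 hθ hw
  have hre0 : ∀ i, 0 ≤ (w i).re + ‖w 0‖ := fun i => by
    have h1 : (w 0).re ≤ (w i).re := hmono i.zero_le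
    linarith [(abs_le.1 (Complex.abs_re_le_norm (w 0))).1]
  set W := ‖w 0‖ with hW
  have hW0 : 0 ≤ W := norm_nonneg _
  set K := m⁻¹ * (c.γ 1 / 2) with hK
  have hK0 : 0 ≤ K := by positivity
  -- With this value, `norm_orbit_le` gives $\|w_i+\gamma_k\|\le C\gamma_k^2$ as long as
  -- $\operatorname{Re}w_i\le\gamma_k^2$.
  set C := 1 + W + (1 + W) / Real.cos θ with hC
  have hC1 : 1 ≤ C := by
    have : 0 ≤ (1 + W) / Real.cos θ := by positivity
    linarith
  set η := (2 * π * c.ε k + C / k) / Real.cos θ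
  have hη : 0 ≤ η := by positivity
  have hdiv : ∀ g : ℝ, 1 ≤ g → (g + W) / Real.cos θ ≤ (1 + W) / Real.cos θ * g := by
    intro g hg
    rw [div_mul_eq_mul_div]
    gcongr
    nlinarith
  have hstep : ∀ i, (w i).re ≤ c.γ k ^ 2 →
      tilt θ (side k) (w i) ≤ (W + K + (1 + W) / Real.cos θ) * c.γ k + η * ((w i).re + W) →
      tilt θ (side k) (w (i + 1)) ≤
        (W + K + (1 + W) / Real.cos θ) * c.γ k + η * ((w (i + 1)).re + W) := by
    intro i hi hprev
    -- Up to $\gamma_k$ the direction of motion is irrelevant, since the whole vector `w (i + 1)`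
    -- has size $O(\gamma_k)$; beyond it, the $k$-th summand dominates.
    by_cases hcase : (w i).re ≤ c.γ k
    · refine le_add_of_le_of_nonneg ?_ (mul_nonneg hη (hre0 _))
      refine (tilt_le_norm (side_sq k) θ _).trans ?_
      rw [hw.step]
      refine (norm_add_le _ _).trans ?_
      have h1 := h.norm_orbit_le h0 hθ hw i
      have h2 := h.norm_displacement_le hθ (hw.dominated i)
      have h3 := hdiv (c.γ k) (by linarith)
      have h4 := div_le_div_of_nonneg_right (add_le_add_left hcase W) hcos.le
      refine (add_le_add h1 h2).trans ?_
      have h5 : W + K ≤ (W + K) * c.γ k := by nlinarith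
      rw [← hW, ← hK]
      linarith
    · push Not at hcase
      have hbig : ‖w i + c.γ k‖ ≤ C * c.γ k ^ 2 := by
        refine (norm_add_le _ _).trans ?_
        rw [Complex.norm_real, Real.norm_of_nonneg (by linarith)]
        have h1 := h.norm_orbit_le h0 hθ hw i
        have h3 := hdiv (c.γ k ^ 2) (by nlinarith)
        have h4 := div_le_div_of_nonneg_right (add_le_add_left hi W) hcos.le
        refine (add_le_add_left h1 _).trans ?_
        rw [← hW, hC]
        have h5 : W ≤ W * c.γ k ^ 2 := le_mul_of_one_le_right hW0 (by nlinarith)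
        nlinarith
      have hdisp := h.tilt_displacement_le h0 hθ hk hC1 hcase.le hbig
      rw [hw.step, tilt_add, Complex.add_re]
      linarith
  induction n with
  | zero =>
    refine hstep 0 hn (le_add_of_le_of_nonneg ?_ (mul_nonneg hη (hre0 _)))
    refine (tilt_le_norm (side_sq k) θ _).trans ?_
    have : 0 ≤ (1 + W) / Real.cos θ := by positivity
    nlinarith
  | succ n ih => exact hstep (n + 1) hn (ih ((hmono (Nat.le_succ n)).trans hn))

/-- At the moment when the real part of an orbit first exceeds `γ_k ^ 2`, its slope is close to
that of the ray `arg = ± θ`. -/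
lemma exists_slope_error (h : c.Admissible θ) (h0 : 0 < θ) (hθ : θ < π / 2)
    (hw : c.IsOrbit m w) : ∃ δ : ℕ → ℝ, Tendsto δ atTop (𝓝 0) ∧ ∀ k, 1 ≤ k → ∀ n,
      c.γ k ^ 2 < (w n).re → (∀ j < n, (w j).re ≤ c.γ k ^ 2) →
        |(w n).im / (w n).re - side k * Real.tan θ| ≤ δ k := by
  have hcos : 0 < Real.cos θ := Real.cos_pos_of_mem_Ioo ⟨by linarith, hθ⟩
  have hm := (hw.dominated 0).1
  have hγ1 := h.γ_pos 1 le_rfl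
  have hpi := Real.pi_pos
  have hW0 : 0 ≤ ‖w 0‖ := norm_nonneg _
  set W := ‖w 0‖ with hW
  obtain ⟨B, hB⟩ : ∃ B, B = W + m⁻¹ * (c.γ 1 / 2) + (1 + W) / Real.cos θ := ⟨_, rfl⟩
  obtain ⟨C, hC⟩ : ∃ C, C = 1 + W + (1 + W) / Real.cos θ := ⟨_, rfl⟩
  have hBW : W ≤ B := by
    have : 0 ≤ m⁻¹ * (c.γ 1 / 2) + (1 + W) / Real.cos θ := by positivity
    linarith
  have hC0 : 0 ≤ C := by rw [hC]; positivity
  -- The first term is the $O(\gamma_k)$ entry error divided by a real part above $\gamma_k^2$; the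
  -- second is the angular error accumulated between $\gamma_k$ and $\gamma_k^2$.
  refine ⟨fun k => (B / c.γ k + (2 * π * c.ε k + C / k) / Real.cos θ * (1 + W)) / Real.cos θ,
    ?_, ?_⟩
  · have h1 : Tendsto (fun k => B / c.γ k) atTop (𝓝 0) :=
      Tendsto.div_atTop tendsto_const_nhds h.tendsto_γ
    have h2 : Tendsto (fun k : ℕ => C / k) atTop (𝓝 0) :=
      tendsto_const_div_atTop_nhds_zero_nat C
    have h3 := (h1.add ((((h.ε_lim.const_mul (2 * π)).add h2).div_const (Real.cos θ)).mul_const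
      (1 + W))).div_const (Real.cos θ)
    simpa using h3
  · intro k hk n hn hlt
    have hγk := h.two_le_γ hk
    have hε := h.ε_pos k hk
    obtain ⟨η, hη⟩ : ∃ η, η = (2 * π * c.ε k + C / k) / Real.cos θ := ⟨_, rfl⟩
    have hη0 : 0 ≤ η := by rw [hη]; positivity
    have hlow : -W ≤ tilt θ (side k) (w n) :=
      (neg_norm_le_tilt (side_sq k) θ (w 0)).trans (h.monotone_tilt hθ hw (side_sq k) n.zero_le)
    have hpos : 0 < (w n).re := lt_trans (by positivity) hn
    have hup : tilt θ (side k) (w n) ≤ B * c.γ k + η * ((w n).re + W) := by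
      cases n with
      | zero =>
        refine le_add_of_le_of_nonneg ?_ (mul_nonneg hη0 (by linarith))
        refine (tilt_le_norm (side_sq k) θ _).trans ?_
        nlinarith
      | succ n =>
        rw [hη, hB, hC]
        exact h.tilt_orbit_succ_le h0 hθ hw hk n (hlt n n.lt_succ_self)
    have hx1 : 1 ≤ (w n).re := by nlinarith
    have hBγ : B * c.γ k ≤ B / c.γ k * (w n).re := by
      rw [div_mul_eq_mul_div, le_div_iff₀ (by linarith)]
      nlinarith [hW0.trans hBW]
    have hE : |tilt θ (side k) (w n)| ≤ (B / c.γ k + η * (1 + W)) * (w n).re := by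
      have e1 : η * ((w n).re + W) ≤ η * (1 + W) * (w n).re := by
        rw [mul_assoc]
        gcongr
        nlinarith
      rw [abs_le]
      constructor
      · have : W ≤ B * c.γ k := by nlinarith
        nlinarith [mul_nonneg hη0 (by linarith : 0 ≤ 1 + W)]
      · linarith
    have heq : (w n).im / (w n).re - side k * Real.tan θ =
        -(side k * tilt θ (side k) (w n)) / (Real.cos θ * (w n).re) := by
      rw [Real.tan_eq_sin_div_cos, tilt]
      field_simp
      linear_combination (-(w n).im * Real.cos θ) * side_sq k
    have habs : |side k| = 1 := by rcases side_eq k with hs | hs <;> simp [hs]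
    rw [heq, abs_div, abs_neg, abs_mul, habs, one_mul, abs_of_pos (mul_pos hcos hpos),
      div_le_div_iff₀ (by positivity) hcos, ← hη]
    nlinarith

/-- The slopes along an orbit are eventually trapped near `[-tan θ, tan θ]`. -/
lemma abs_slope_le (h : c.Admissible θ) (h0 : 0 < θ) (hθ : θ < π / 2)
    (hw : c.IsOrbit m w) {n : ℕ} (hn : 0 < (w n).re) :
    |(w n).im / (w n).re| ≤ Real.tan θ + ‖w 0‖ / Real.cos θ / (w n).re := by
  have hcos : 0 < Real.cos θ := Real.cos_pos_of_mem_Ioo ⟨by linarith, hθ⟩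
  have key : ∀ s : ℝ, s ^ 2 = 1 → -‖w 0‖ ≤ tilt θ s (w n) := fun s hs =>
    (neg_norm_le_tilt hs θ (w 0)).trans (h.monotone_tilt hθ hw hs n.zero_le)
  have h1 := key 1 (by norm_num)
  have h2 := key (-1) (by norm_num)
  simp only [tilt] at h1 h2
  rw [abs_div, abs_of_pos hn, Real.tan_eq_sin_div_cos, div_le_iff₀ hn]
  have : (Real.sin θ / Real.cos θ + ‖w 0‖ / Real.cos θ / (w n).re) * (w n).re =
      (Real.sin θ * (w n).re + ‖w 0‖) / Real.cos θ := by field_simp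
  rw [this, le_div_iff₀ hcos]
  rcases abs_cases (w n).im with ⟨e, -⟩ | ⟨e, -⟩ <;> rw [e] <;> nlinarith

/-- With $w=x+iy$ and displacement $d$, the increment is
$\operatorname{Im}d/x'-(y/x)\operatorname{Re}d/x'$, where $x'$ is the next real part; $d\to0$,
$x'\to\infty$ and $y/x$ is bounded. -/
lemma tendsto_slope_sub (h : c.Admissible θ) (h0 : 0 < θ) (hθ : θ < π / 2)
    (hw : c.IsOrbit m w) :
    Tendsto (fun n => (w (n + 1)).im / (w (n + 1)).re - (w n).im / (w n).re) atTop (𝓝 0) := by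
  have hre := h.tendsto_re h0 hθ hw
  have hre' := (tendsto_add_atTop_iff_nat 1).2 hre
  have hd := h.tendsto_displacement h0 hθ hw
  have hdi : Tendsto (fun n => (c.displacement (w n)).im) atTop (𝓝 0) := 
    (Complex.continuous_im.tendsto 0).comp hd
  have hdr : Tendsto (fun n => (c.displacement (w n)).re) atTop (𝓝 0) := 
    (Complex.continuous_re.tendsto 0).comp hd
  have h1 : Tendsto (fun n => (c.displacement (w n)).im / (w (n + 1)).re) atTop (𝓝 0) :=
    hdi.div_atTop hre'
  have h2 : Tendsto (fun n => (c.displacement (w n)).re / (w (n + 1)).re) atTop (𝓝 0) :=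
    hdr.div_atTop hre'
  have hbd : ∀ᶠ n in atTop, |(w n).im / (w n).re| ≤ Real.tan θ + ‖w 0‖ / Real.cos θ := by
    filter_upwards [hre.eventually_ge_atTop 1] with n hn
    refine (h.abs_slope_le h0 hθ hw (by linarith)).trans ?_
    have hcos : 0 < Real.cos θ := Real.cos_pos_of_mem_Ioo ⟨by linarith, hθ⟩
    have := div_le_self (div_nonneg (norm_nonneg (w 0)) hcos.le) hn
    linarith
  have h3 : Tendsto (fun n => (w n).im / (w n).re *
      ((c.displacement (w n)).re / (w (n + 1)).re)) atTop (𝓝 0) :=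
    bdd_le_mul_tendsto_zero' _ hbd h2
  have h4 := h1.sub h3
  rw [sub_zero] at h4
  refine h4.congr' ?_
  filter_upwards [hre.eventually_gt_atTop 0, hre'.eventually_gt_atTop 0] with n hn hn'
  rw [sub_eq_sub_iff_add_eq_add]
  have e1 : (w (n + 1)).im = (w n).im + (c.displacement (w n)).im := by
    rw [hw.step, Complex.add_im]
  have e2 : (w (n + 1)).re = (w n).re + (c.displacement (w n)).re := by
    rw [hw.step, Complex.add_re]
  rw [e1]
  have e3 : (c.displacement (w n)).re = (w (n + 1)).re - (w n).re := by linarith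
  rw [e3]
  field_simp
  ring

end Admissible

end SlopeCoeffs

/-! ### Existence of admissible coefficients. -/

namespace SlopeCoeffs

lemma Δ_pos (θ : ℝ) : 0 < Δ θ := by
  rw [Δ]; positivity

/-- An explicit admissible choice of coefficients. -/
noncomputable def explicit (θ : ℝ) : SlopeCoeffs where
  a _ := 1
  γ k := Real.exp (4 / Δ θ * π / θ * 64 ^ k)
  ε k := θ / π / 8 ^ k
  ϑ k := side k * (θ - π * (θ / π / 8 ^ k))

/-- The size at the origin of the `k`-th summand of the explicit example. -/
noncomputable def explicitSize (θ : ℝ) (k : ℕ) : ℝ := Real.exp (-(4 / Δ θ * 8 ^ k))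

/-- The factor $\pi/\theta$ in $\log\gamma_k$ cancels the $\theta/\pi$ in $\epsilon_l$, so every
condition becomes a comparison of powers of 8. -/
lemma explicit_rpow {θ : ℝ} (h0 : 0 < θ) (k l : ℕ) :
    (explicit θ).γ k ^ (explicit θ).ε l = Real.exp (4 / Δ θ * (64 ^ k / 8 ^ l)) := by
  have := (Δ_pos θ).ne'
  have hpi := Real.pi_pos.ne'
  simp only [explicit]
  rw [← Real.exp_mul]
  congr 1
  field_simp

lemma explicit_div_rpow {θ : ℝ} (h0 : 0 < θ) (k : ℕ) :
    (explicit θ).a k / (explicit θ).γ k ^ (explicit θ).ε k = explicitSize θ k := by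
  rw [explicit_rpow h0, explicitSize, Real.exp_neg, ← one_div]
  congr 3
  rw [show (64 : ℝ) = 8 * 8 by norm_num, mul_pow]
  field_simp

lemma explicitSize_pos (θ : ℝ) (k : ℕ) : 0 < explicitSize θ k := Real.exp_pos _

/-- This follows from $x+1\le e^x$; it lets one spare power of the size absorb both $\Delta(\theta)$
and a factor $k$. -/
lemma explicitSize_mul_le (θ : ℝ) (k : ℕ) : explicitSize θ k * (4 * 8 ^ k) ≤ Δ θ := by
  have hΔ := Δ_pos θ
  have h1 := Real.add_one_le_exp (4 / Δ θ * 8 ^ k)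
  rw [explicitSize, Real.exp_neg, inv_mul_le_iff₀ (Real.exp_pos _)]
  calc (4 * 8 ^ k : ℝ) = 4 / Δ θ * 8 ^ k * Δ θ := by field_simp
    _ ≤ _ := by gcongr; linarith

lemma explicitSize_le (θ : ℝ) (k : ℕ) : explicitSize θ k ≤ 1 / 4 := by
  have h1 := explicitSize_mul_le θ k
  have h2 := Admissible.Δ_le_one θ
  have h3 : (1 : ℝ) ≤ 8 ^ k := one_le_pow₀ (by norm_num)
  nlinarith [explicitSize_pos θ k]

lemma explicitSize_mul_natCast_le (θ : ℝ) (k : ℕ) : explicitSize θ k * (4 * k) ≤ Δ θ := by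
  refine le_trans ?_ (explicitSize_mul_le θ k)
  have := (explicitSize_pos θ k).le
  gcongr
  exact_mod_cast (Nat.lt_pow_self (by norm_num : 1 < 8)).le

lemma exp_mul_le_explicitSize_pow {θ : ℝ} (k n : ℕ) {x : ℝ} (hx : n * 8 ^ k ≤ x) :
    Real.exp (-(4 / Δ θ * x)) ≤ explicitSize θ k ^ n := by
  rw [explicitSize, ← Real.exp_nat_mul]
  refine Real.exp_le_exp.2 ?_
  have : 4 / Δ θ * (n * 8 ^ k) ≤ 4 / Δ θ * x :=
    mul_le_mul_of_nonneg_left hx (div_nonneg (by norm_num) (Δ_pos θ).le)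
  linarith

lemma explicitSize_add_le (θ : ℝ) (k l : ℕ) :
    explicitSize θ (k + 1 + l) ≤ explicitSize θ k ^ 3 * explicitSize θ k ^ l := by
  rw [← pow_add, explicitSize]
  refine exp_mul_le_explicitSize_pow k (3 + l) ?_
  have h : 3 + l ≤ 8 ^ (l + 1) := by
    have := (Nat.lt_pow_self (by norm_num : 1 < 8) : l < 8 ^ l)
    rw [pow_succ]; omega
  rw [show k + 1 + l = (l + 1) + k by ring, pow_add]
  gcongr
  exact_mod_cast h

lemma hasSum_explicit_majorant (θ : ℝ) (k : ℕ) :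
    HasSum (fun l => explicitSize θ k ^ 3 * explicitSize θ k ^ l)
      (explicitSize θ k ^ 3 * (1 - explicitSize θ k)⁻¹) :=
  (hasSum_geometric_of_lt_one (explicitSize_pos θ k).le
    ((explicitSize_le θ k).trans_lt (by norm_num))).mul_left _

lemma summable_explicitSize (θ : ℝ) (k : ℕ) :
    Summable fun l => explicitSize θ (k + 1 + l) :=
  Summable.of_nonneg_of_le (fun _ => (explicitSize_pos θ _).le) (explicitSize_add_le θ k)
    (hasSum_explicit_majorant θ k).summable

lemma tsum_explicitSize_le (θ : ℝ) (k : ℕ) :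
    ∑' l, explicitSize θ (k + 1 + l) ≤ 2 * explicitSize θ k ^ 3 := by
  have hq := explicitSize_le θ k
  have hp := explicitSize_pos θ k
  refine ((summable_explicitSize θ k).tsum_le_tsum (explicitSize_add_le θ k)
    (hasSum_explicit_majorant θ k).summable).trans ?_
  rw [(hasSum_explicit_majorant θ k).tsum_eq, mul_comm]
  gcongr
  rw [inv_le_comm₀ (by linarith) (by norm_num)]
  linarith

lemma explicit_bound {θ : ℝ} (h0 : 0 < θ) (k : ℕ) :
    Δ θ * (explicit θ).a k / (2 * k * (explicit θ).γ k ^ (2 * (explicit θ).ε k)) =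
      Δ θ / (2 * k) * explicitSize θ k ^ 2 := by
  have h := explicit_div_rpow h0 k
  have ha : (explicit θ).a k = 1 := rfl
  have hγ : 0 ≤ (explicit θ).γ k := (Real.exp_pos _).le
  rw [← h, ha, mul_comm 2 ((explicit θ).ε k), Real.rpow_mul hγ]
  norm_num
  rw [div_eq_mul_inv, mul_inv]
  ring

/-- With $q$ the size of the $k$-th summand at $0$, the allowed bound is $\Delta q^2/(2k)$, while
each head term is at most $q^8$ and the tail at most $2q^3$; $4kq\le\Delta$ closes the gap. -/
lemma explicit_admissible {θ : ℝ} (h0 : 0 < θ) (hθ : θ < π / 2) : (explicit θ).Admissible θ := by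
  have hpi := Real.pi_pos
  have hΔ := Δ_pos θ
  have hC : 1 ≤ 4 / Δ θ * π / θ := by
    have h1 : 1 ≤ 4 / Δ θ := by
      rw [le_div_iff₀ hΔ]; linarith [Admissible.Δ_le_one θ]
    rw [le_div_iff₀ h0]
    nlinarith
  have hπε : ∀ k, π * (explicit θ).ε k = θ / 8 ^ k := fun k => by
    simp only [explicit]
    field_simp
  refine
    { a_pos := fun k _ => one_pos
      γ_pos := fun k _ => Real.exp_pos _
      ε_pos := fun k _ => by simp only [explicit]; positivity
      ε_le := fun k _ => ?_
      ε_lim := ?_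
      angle_even := fun k _ => ?_
      angle_odd := fun k hk => ?_
      step_summable := ?_
      step := ?_
      γ_one := ?_
      γ_growth := fun k _ => ?_
      head_le := fun k hk => ?_
      tail_le := fun k hk => ?_ }
  · rw [hπε]
    exact div_le_self h0.le (one_le_pow₀ (by norm_num))
  · exact Tendsto.div_atTop tendsto_const_nhds (tendsto_pow_atTop_atTop_of_one_lt (by norm_num))
  · simp [explicit, side]
  · obtain ⟨j, rfl⟩ : ∃ j, k = j + 1 := ⟨k - 1, by omega⟩
    rw [show 2 * (j + 1) - 1 = 2 * j + 1 by omega]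
    simp [explicit, side]
  · simp only [explicit_div_rpow h0]
    simpa only [zero_add, add_comm] using summable_explicitSize θ 0
  · simp only [explicit_div_rpow h0]
    have h1 := tsum_explicitSize_le θ 0
    simp only [zero_add, add_comm 1] at h1
    have h2 : 2 * explicitSize θ 0 ^ 3 ≤ 1 := by
      have := pow_le_pow_left₀ (explicitSize_pos θ 0).le (explicitSize_le θ 0) 3
      linarith
    have h3 := Real.add_one_le_exp (4 / Δ θ * π / θ * 64 ^ 1)
    have h4 : (explicit θ).γ 1 = Real.exp (4 / Δ θ * π / θ * 64 ^ 1) := rfl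
    rw [h4]
    linarith
  · have h3 := Real.add_one_le_exp (4 / Δ θ * π / θ * 64 ^ 1)
    have h4 : (explicit θ).γ 1 = Real.exp (4 / Δ θ * π / θ * 64 ^ 1) := rfl
    rw [h4]
    linarith
  · simp only [explicit]
    rw [← Real.exp_nat_mul]
    refine Real.exp_lt_exp.2 ?_
    have : 0 < 4 / Δ θ * π / θ * 64 ^ k := by positivity
    rw [pow_succ]
    push_cast
    linarith
  · rw [explicit_bound h0]
    have hk0 : (0 : ℝ) < k := by exact_mod_cast hk
    set q := explicitSize θ k with hq
    have hq0 : 0 < q := explicitSize_pos θ k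
    have hq1 : q ≤ 1 / 4 := explicitSize_le θ k
    have hle : ∀ l ∈ Finset.Ico 1 k, (explicit θ).a l / (explicit θ).γ k ^ (explicit θ).ε l
        ≤ q ^ 8 := by
      intro l hl
      rw [explicit_rpow h0, show (explicit θ).a l = 1 from rfl, one_div, ← Real.exp_neg]
      -- Since $l<k$, $64^k/8^l=8^k\cdot8^{k-l}\ge8\cdot8^k$.
      refine exp_mul_le_explicitSize_pow k 8 ?_
      rw [le_div_iff₀ (by positivity), show (64 : ℝ) = 8 * 8 by norm_num, mul_pow]
      have : (8 : ℝ) ^ (l + 1) ≤ 8 ^ k :=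
        pow_le_pow_right₀ (by norm_num) (Finset.mem_Ico.1 hl).2
      rw [pow_succ] at this
      have h8 : (0 : ℝ) < 8 ^ k := by positivity
      push_cast
      nlinarith
    have hcard : ((k - 1 : ℕ) : ℝ) ≤ k := by exact_mod_cast Nat.sub_le k 1
    have hqk : q * (4 * k) ≤ Δ θ := explicitSize_mul_natCast_le θ k
    calc _ ≤ (Finset.Ico 1 k).card • q ^ 8 := Finset.sum_le_card_nsmul _ _ _ hle
      _ = ((k - 1 : ℕ) : ℝ) * q ^ 8 := by rw [Nat.card_Ico, nsmul_eq_mul]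
      _ ≤ k * q ^ 8 := by gcongr
      _ ≤ Δ θ / (2 * k) * q ^ 2 := by
        rw [div_mul_eq_mul_div, le_div_iff₀ (by positivity)]
        have h2 : (q * (4 * k)) ^ 2 ≤ Δ θ := by
          have h1 := Admissible.Δ_le_one θ
          have h3 : 0 ≤ q * (4 * k) := by positivity
          nlinarith
        have h4 : q ^ 4 ≤ 1 := pow_le_one₀ hq0.le (by linarith)
        calc k * q ^ 8 * (2 * k) = q ^ 4 * ((q * (4 * k)) ^ 2 / 8) * q ^ 2 := by ring
          _ ≤ 1 * Δ θ * q ^ 2 := by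
            gcongr
            linarith
          _ = _ := by ring
  · rw [explicit_bound h0]
    simp only [explicit_div_rpow h0]
    have hk0 : (0 : ℝ) < k := by exact_mod_cast hk
    refine (tsum_explicitSize_le θ k).trans ?_
    have hqk := explicitSize_mul_natCast_le θ k
    have hp := explicitSize_pos θ k
    rw [div_mul_eq_mul_div, le_div_iff₀ (by positivity)]
    calc 2 * explicitSize θ k ^ 3 * (2 * k)
        = (explicitSize θ k * (4 * k)) * explicitSize θ k ^ 2 := by ring
      _ ≤ _ := by gcongr

end SlopeCoeffs

/-! ### Cluster points of slowly varying sequences, and rotations. -/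

/-- A real sequence with vanishing increments accumulates at every point between two of its
accumulation points. -/
lemma mapClusterPt_of_mem_Icc {x : ℕ → ℝ}
    (hx : Tendsto (fun n => x (n + 1) - x n) atTop (𝓝 0)) {a b s : ℝ}
    (ha : MapClusterPt a atTop x) (hb : MapClusterPt b atTop x) (hs : s ∈ Set.Icc a b) :
    MapClusterPt s atTop x := by
  rcases hs.1.eq_or_lt with rfl | has
  · exact ha
  rcases hs.2.eq_or_lt with rfl | hsb
  · exact hb
  refine mapClusterPt_iff_frequently.2 fun u hu => ?_
  obtain ⟨δ, hδ, hball⟩ := Metric.mem_nhds_iff.1 hu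
  obtain ⟨N, hN⟩ := eventually_atTop.1 ((Metric.tendsto_nhds.1 hx) δ hδ)
  refine frequently_atTop.2 fun M => ?_
  obtain ⟨n₁, hn₁, h₁⟩ := frequently_atTop.1
    (mapClusterPt_iff_frequently.1 ha _ (Iio_mem_nhds has)) (max M N)
  obtain ⟨n₂, hn₂, h₂⟩ := frequently_atTop.1
    (mapClusterPt_iff_frequently.1 hb _ (Ioi_mem_nhds hsb)) n₁
  -- Discrete intermediate values: an upward crossing of `s` by a step shorter than `δ` lands within
  -- `δ` of `s`.
  obtain ⟨j, hj, hlt, hge⟩ : ∃ j, n₁ ≤ j ∧ x j < s ∧ s ≤ x (j + 1) := by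
    by_contra! hcon
    have : ∀ j, n₁ ≤ j → x j < s := fun j hj => by
      induction j, hj using Nat.le_induction with
      | base => exact h₁
      | succ j hj ih => exact hcon j hj ih
    exact lt_asymm (this n₂ hn₂) h₂
  refine ⟨j + 1, (le_max_left M N).trans (hn₁.trans (by omega)), hball ?_⟩
  have := hN j ((le_max_right M N).trans (hn₁.trans hj))
  rw [Real.dist_eq, sub_zero, abs_lt] at this
  rw [Metric.mem_ball, Real.dist_eq, abs_lt]
  constructor <;> linarith

lemma Real.abs_arctan_sub_le (x y : ℝ) : |Real.arctan x - Real.arctan y| ≤ |x - y| := by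
  have h := Convex.norm_image_sub_le_of_norm_deriv_le (f := Real.arctan) (s := Set.univ) (C := 1)
    (fun x _ => Real.differentiableAt_arctan x) (fun x _ => ?_) convex_univ (Set.mem_univ y)
    (Set.mem_univ x)
  · simpa using h
  · rw [Real.deriv_arctan, Real.norm_of_nonneg (by positivity), div_le_one (by positivity)]
    nlinarith [sq_nonneg x]

lemma tendsto_two_mul : Tendsto (fun k : ℕ => 2 * k) atTop atTop :=
  tendsto_atTop_mono (fun k => by simp only [id]; omega) tendsto_id

lemma tendsto_two_mul_add_one : Tendsto (fun k : ℕ => 2 * k + 1) atTop atTop :=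
  tendsto_atTop_mono (fun k => by simp only [id]; omega) tendsto_id

lemma exp_I_mul_mul_im (φ : ℝ) (v : ℂ) :
    (Complex.exp (Complex.I * φ) * v).im = Real.sin φ * v.re + Real.cos φ * v.im := by
  rw [mul_comm Complex.I, Complex.mul_im, Complex.exp_ofReal_mul_I_re,
    Complex.exp_ofReal_mul_I_im]
  ring

lemma exp_I_mul_mul_conj (φ : ℝ) (z : ℂ) :
    Complex.exp (Complex.I * φ) * (starRingEnd ℂ (Complex.exp (Complex.I * φ)) * z) = z := by
  rw [← mul_assoc, Complex.mul_conj, Complex.normSq_eq_norm_sq, Complex.norm_exp_I_mul_ofReal]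
  simp

lemma conj_exp_I_mul_mul (φ : ℝ) (z : ℂ) :
    starRingEnd ℂ (Complex.exp (Complex.I * φ)) * (Complex.exp (Complex.I * φ) * z) = z := by
  rw [mul_left_comm, exp_I_mul_mul_conj]

lemma norm_conj_exp_I_mul_mul (φ : ℝ) (z : ℂ) :
    ‖starRingEnd ℂ (Complex.exp (Complex.I * φ)) * z‖ = ‖z‖ := by
  rw [norm_mul, RCLike.norm_conj, Complex.norm_exp_I_mul_ofReal, one_mul]

/-- Rotation by $\varphi\in[\theta,\pi-\theta]$ carries the sector $|\arg|\le\theta$ into the closed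
upper half-plane. -/
lemma exp_I_mul_mul_im_nonneg {θ φ : ℝ} (h0 : 0 < θ) (hφ : φ ∈ Set.Icc θ (π - θ))
    (hθ : θ < π / 2) {v : ℂ} (h1 : 0 ≤ tilt θ 1 v) (h2 : 0 ≤ tilt θ (-1) v) :
    0 ≤ (Complex.exp (Complex.I * φ) * v).im := by
  have hcos : 0 < Real.cos θ := Real.cos_pos_of_mem_Ioo ⟨by linarith, hθ⟩
  have hre : 0 ≤ v.re := le_trans (by positivity) (norm_mul_cos_le_re h0 hθ h1 h2)
  have habs := abs_im_mul_cos_le h1 h2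
  have hc : |Real.cos φ| ≤ Real.cos θ := by
    rw [abs_le, ← Real.cos_pi_sub]
    exact ⟨Real.cos_le_cos_of_nonneg_of_le_pi (by linarith [hφ.1]) (by linarith) hφ.2,
      Real.cos_le_cos_of_nonneg_of_le_pi h0.le (by linarith [hφ.2]) hφ.1⟩
  have hs : Real.sin θ ≤ Real.sin φ := by
    refine le_of_sq_le_sq ?_ (Real.sin_nonneg_of_nonneg_of_le_pi (by linarith [hφ.1])
      (by linarith [hφ.2]))
    rw [Real.sin_sq, Real.sin_sq, ← sq_abs (Real.cos φ)]
    have := pow_le_pow_left₀ (abs_nonneg _) hc 2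
    linarith
  rw [exp_I_mul_mul_im]
  have e1 : -(Real.cos φ * v.im) ≤ Real.sin θ * v.re := by
    refine (neg_le_abs _).trans (le_trans ?_ habs)
    rw [abs_mul, abs_mul, abs_of_pos hcos]
    gcongr
  nlinarith

/-- Both $\arg z$ and $\varphi$ lie in $(0,\pi)$, so their difference is already a principal
argument. -/
lemma UpperHalfPlane.arg_eq_add_arctan (z : ℍ) {φ : ℝ} (hφ : φ ∈ Set.Ioo 0 π) {w : ℂ}
    (hw : starRingEnd ℂ (Complex.exp (Complex.I * φ)) * (z : ℂ) = w) (hre : 0 < w.re) :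
    Complex.arg (z : ℂ) = φ + Real.arctan (w.im / w.re) := by
  have hz0 : 0 < ‖(z : ℂ)‖ := norm_pos_iff.2 z.ne_zero
  have hpos : 0 < Complex.arg (z : ℂ) := by
    rcases (Complex.arg_nonneg_iff.2 z.im_pos.le).eq_or_lt with h | h
    · exact absurd (Complex.arg_eq_zero_iff.1 h.symm).2 z.im_pos.ne'
    · exact h
  have hle := Complex.arg_le_pi (z : ℂ)
  have hw' : w = (‖(z : ℂ)‖ : ℂ) * (Complex.cos ((Complex.arg (z : ℂ) - φ : ℝ) : ℂ) +
      Complex.sin ((Complex.arg (z : ℂ) - φ : ℝ) : ℂ) * Complex.I) := by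
    rw [← Complex.exp_mul_I, ← hw, ← Complex.exp_conj]
    conv_lhs => rw [← Complex.norm_mul_exp_arg_mul_I (z : ℂ)]
    rw [mul_left_comm, ← Complex.exp_add]
    simp only [map_mul, Complex.conj_I, Complex.conj_ofReal, Complex.ofReal_sub]
    congr 2
    ring
  have harg : w.arg = Complex.arg (z : ℂ) - φ := by
    rw [hw']
    exact Complex.arg_mul_cos_add_sin_mul_I hz0 ⟨by linarith [hφ.2], by linarith [hφ.1]⟩
  have habs := abs_lt.1 (Complex.abs_arg_lt_pi_div_two_iff.2 (Or.inl hre))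
  rw [← Complex.tan_arg, Real.arctan_tan habs.1 habs.2, harg]
  ring

/-! ### Exit times and the conjugate self-map of the half-plane. -/

namespace SlopeCoeffs

/-- The first time at which the real part of `w` exceeds `γ_k ^ 2`. -/
noncomputable def firstExit (c : SlopeCoeffs) (w : ℕ → ℂ) (k : ℕ) : ℕ :=
  sInf {n : ℕ | c.γ k ^ 2 < (w n).re}

/-- Adding $\gamma_k$ raises the imaginary part after rotation by $\gamma_k\sin\varphi$, so
$m=\sin\varphi$ serves the whole half-plane at once. -/
lemma dominated_of_im_pos {c : SlopeCoeffs} {φ : ℝ} (hφ : φ ∈ Set.Ioo 0 π) {w : ℂ}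
    (hw : 0 < (Complex.exp (Complex.I * φ) * w).im) :
    c.Dominated (Real.sin φ) w := by
  refine ⟨Real.sin_pos_of_pos_of_lt_pi hφ.1 hφ.2, Real.sin_le_one φ, fun k hk => ?_⟩
  have h1 : ‖w + c.γ k‖ = ‖Complex.exp (Complex.I * φ) * (w + c.γ k)‖ := by
    rw [norm_mul, Complex.norm_exp_I_mul_ofReal, one_mul]
  rw [h1]
  refine le_trans ?_ (Complex.im_le_norm _)
  rw [mul_add, Complex.add_im, exp_I_mul_mul_im φ (c.γ k)]
  simp only [Complex.ofReal_re, Complex.ofReal_im, mul_zero, add_zero]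
  linarith

namespace Admissible

variable {c : SlopeCoeffs} {θ m φ : ℝ} {w : ℕ → ℂ} {f : ℍ → ℍ}

lemma γ_le_γ (h : c.Admissible θ) {k l : ℕ} (hk : 1 ≤ k) (hl : k ≤ l) : c.γ k ≤ c.γ l := by
  induction l, hl using Nat.le_induction with
  | base => exact le_rfl
  | succ l hl ih => nlinarith [h.γ_growth l (hk.trans hl), h.two_le_γ (hk.trans hl)]

lemma exists_exit (h : c.Admissible θ) (h0 : 0 < θ) (hθ : θ < π / 2) (hw : c.IsOrbit m w)
    (k : ℕ) : ∃ n, c.γ k ^ 2 < (w n).re :=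
  ((h.tendsto_re h0 hθ hw).eventually_gt_atTop _).exists

lemma lt_re_firstExit (h : c.Admissible θ) (h0 : 0 < θ) (hθ : θ < π / 2) (hw : c.IsOrbit m w)
    (k : ℕ) : c.γ k ^ 2 < (w (c.firstExit w k)).re :=
  Nat.sInf_mem (h.exists_exit h0 hθ hw k)

lemma _root_.SlopeCoeffs.re_le_of_lt_firstExit {k j : ℕ} (hj : j < c.firstExit w k) :
    (w j).re ≤ c.γ k ^ 2 :=
  not_lt.1 (Nat.notMem_of_lt_sInf hj)

lemma tendsto_firstExit (h : c.Admissible θ) (h0 : 0 < θ) (hθ : θ < π / 2)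
    (hw : c.IsOrbit m w) : Tendsto (c.firstExit w) atTop atTop := by
  refine tendsto_atTop.2 fun M => ?_
  filter_upwards [h.tendsto_γ.eventually_ge_atTop (max 1 (w M).re)] with k hk
  by_contra! hlt
  have h1 := h.monotone_re h0 hθ hw hlt.le
  have h2 := h.lt_re_firstExit h0 hθ hw k
  have h3 := (le_max_left _ _).trans hk
  have h4 := (le_max_right _ _).trans hk
  simp only at h1
  nlinarith

/-- From this start the real part stays nonnegative, so steps have length at most $\gamma_1/2$. The
overshoot at the $k$-th exit is then too small to pass $\gamma_k^4<\gamma_{k+1}^2$. -/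
lemma strictMonoOn_firstExit (h : c.Admissible θ) (h0 : 0 < θ) (hθ : θ < π / 2)
    (hw : c.IsOrbit m w) (hw0 : w 0 = (c.γ 1 / 2 : ℝ)) :
    StrictMonoOn (c.firstExit w) (Set.Ici 1) := by
  intro k hk l _ hkl
  have hk : 1 ≤ k := hk
  have hmono := h.monotone_re h0 hθ hw
  have hγk := h.two_le_γ hk
  have hγ1 := h.γ_le_γ le_rfl hk
  have hγ1' := h.γ_one
  have hw0re : (w 0).re = c.γ 1 / 2 := by rw [hw0, Complex.ofReal_re]
  have hup : (w (c.firstExit w k)).re ≤ c.γ k ^ 2 + c.γ 1 / 2 := by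
    rcases hn : c.firstExit w k with _ | n
    · rw [hw0re]
      nlinarith
    · have h1 : (w n).re ≤ c.γ k ^ 2 := re_le_of_lt_firstExit (by omega)
      have h2 : 0 ≤ (w n).re := by
        have : (w 0).re ≤ (w n).re := hmono n.zero_le
        linarith
      have h3 := h.norm_displacement_le hθ (dominated_one h2)
      have h4 := Complex.re_le_norm (c.displacement (w n))
      rw [hw.step, Complex.add_re]
      linarith
  have hlow := h.lt_re_firstExit h0 hθ hw l
  have hgr := h.γ_growth k hk
  have hγl := h.γ_le_γ (by omega : 1 ≤ k + 1) hkl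
  by_contra! hcon
  have h5 : (w (c.firstExit w l)).re ≤ (w (c.firstExit w k)).re := hmono hcon
  have h6 : c.γ k ^ 2 + c.γ 1 / 2 ≤ (c.γ k ^ 2) ^ 2 := by
    have h8 : 4 ≤ c.γ k ^ 2 := by nlinarith
    nlinarith
  have h7 : (c.γ k ^ 2) ^ 2 ≤ c.γ l ^ 2 :=
    pow_le_pow_left₀ (by positivity) (hgr.le.trans hγl) 2
  linarith

lemma tendsto_slope_firstExit (h : c.Admissible θ) (h0 : 0 < θ) (hθ : θ < π / 2)
    (hw : c.IsOrbit m w) {ψ : ℕ → ℕ} (hψ : Tendsto ψ atTop atTop) {s : ℝ}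
    (hs : ∀ k, side (ψ k) = s) :
    Tendsto (fun k => (w (c.firstExit w (ψ k))).im / (w (c.firstExit w (ψ k))).re) atTop
      (𝓝 (s * Real.tan θ)) := by
  obtain ⟨δ, hδ, hle⟩ := h.exists_slope_error h0 hθ hw
  rw [tendsto_iff_norm_sub_tendsto_zero]
  refine squeeze_zero' (Eventually.of_forall fun _ => norm_nonneg _) ?_ (hδ.comp hψ)
  filter_upwards [hψ.eventually_ge_atTop 1] with k hk
  have := hle (ψ k) hk _ (h.lt_re_firstExit h0 hθ hw (ψ k)) fun j hj => re_le_of_lt_firstExit hj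
  rwa [hs] at this

lemma exp_mul_F_im (h : c.Admissible θ) (h0 : 0 < θ) (hθ : θ < π / 2)
    (hφ : φ ∈ Set.Icc θ (π - θ)) {v : ℂ} (hv : 0 < (Complex.exp (Complex.I * φ) * v).im) :
    (Complex.exp (Complex.I * φ) * v).im ≤ (Complex.exp (Complex.I * φ) * c.F v).im := by
  have hd : c.Dominated (Real.sin φ) v :=
    dominated_of_im_pos ⟨by linarith [hφ.1], by linarith [hφ.2]⟩ hv
  have := exp_I_mul_mul_im_nonneg h0 hφ hθ
    (h.tilt_displacement_nonneg hθ hd (s := 1) (by norm_num))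
    (h.tilt_displacement_nonneg hθ hd (s := -1) (by norm_num))
  rw [F_eq, mul_add, Complex.add_im]
  linarith

/-- The self-map of `ℍ` conjugate to `F` under the rotation by `φ`. -/
lemma exists_selfMap (h : c.Admissible θ) (h0 : 0 < θ) (hθ : θ < π / 2)
    (hφ : φ ∈ Set.Icc θ (π - θ)) : ∃ f : ℍ → ℍ, ∀ z : ℍ, (f z : ℂ) =
      Complex.exp (Complex.I * φ) *
        c.F (starRingEnd ℂ (Complex.exp (Complex.I * φ)) * (z : ℂ)) := by
  refine ⟨fun z => ⟨Complex.exp (Complex.I * φ) *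
    c.F (starRingEnd ℂ (Complex.exp (Complex.I * φ)) * (z : ℂ)), ?_⟩, fun z => rfl⟩
  have hz : (0 : ℝ) < (Complex.exp (Complex.I * φ) *
      (starRingEnd ℂ (Complex.exp (Complex.I * φ)) * (z : ℂ))).im := by
    rw [exp_I_mul_mul_conj]
    exact z.im_pos
  exact hz.trans_le (h.exp_mul_F_im h0 hθ hφ hz)

/-- `f` is the self-map of `ℍ` conjugate to `F` under the rotation by `φ`. -/
def _root_.SlopeCoeffs.IsConjugate (c : SlopeCoeffs) (φ : ℝ) (f : ℍ → ℍ) : Prop :=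
  ∀ z : ℍ, (f z : ℂ) = Complex.exp (Complex.I * φ) *
    c.F (starRingEnd ℂ (Complex.exp (Complex.I * φ)) * (z : ℂ))

lemma dominated_conj_mul (hφ : φ ∈ Set.Ioo 0 π) (z : ℍ) :
    c.Dominated (Real.sin φ) (starRingEnd ℂ (Complex.exp (Complex.I * φ)) * (z : ℂ)) := by
  refine dominated_of_im_pos hφ ?_
  rw [exp_I_mul_mul_conj]
  exact z.im_pos

lemma isOrbit (hφ : φ ∈ Set.Ioo 0 π) (hf : c.IsConjugate φ f) (z : ℍ) :
    c.IsOrbit (Real.sin φ)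
      fun n => starRingEnd ℂ (Complex.exp (Complex.I * φ)) * ((f^[n] z : ℍ) : ℂ) where
  dominated n := dominated_conj_mul hφ _
  step n := by
    rw [Function.iterate_succ_apply', hf, conj_exp_I_mul_mul, F_eq]

lemma coe_sub (hf : c.IsConjugate φ f) (z : ℍ) :
    (f z : ℂ) = z + Complex.exp (Complex.I * φ) *
      c.displacement (starRingEnd ℂ (Complex.exp (Complex.I * φ)) * (z : ℂ)) := by
  rw [hf, F_eq, mul_add, exp_I_mul_mul_conj]

lemma hasDenjoyWolffInfty (h : c.Admissible θ) (h0 : 0 < θ) (hθ : θ < π / 2)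
    (hφ : φ ∈ Set.Ioo 0 π) (hf : c.IsConjugate φ f) : HasDenjoyWolffInfty f := by
  intro K hK R
  obtain ⟨M, hM⟩ := (hK.image UpperHalfPlane.continuous_coe).isBounded.exists_norm_le
  obtain ⟨N, hN⟩ := h.exists_forall_lt_re h0 hθ M R
  filter_upwards [eventually_ge_atTop N] with n hn z hz
  have := hN _ _ (isOrbit hφ hf z) (by
    rw [norm_conj_exp_I_mul_mul]
    exact hM _ ⟨z, hz, rfl⟩) n hn
  refine this.trans_le ((Complex.re_le_norm _).trans ?_)
  rw [norm_conj_exp_I_mul_mul]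

lemma hasAngularLimitInfty (h : c.Admissible θ) (hθ : θ < π / 2)
    (hφ : φ ∈ Set.Ioo 0 π) (hf : c.IsConjugate φ f) :
    HasAngularLimitInfty (fun z => (f z : ℂ) / (z : ℂ)) 1 := by
  intro δ _
  -- The displacement is bounded on the whole half-plane, so the limit is unrestricted and the
  -- sector can be dropped.
  refine Tendsto.mono_left ?_ inf_le_left
  rw [tendsto_iff_norm_sub_tendsto_zero]
  have hlim : Tendsto (fun z : ℍ => (Real.sin φ)⁻¹ * (c.γ 1 / 2) / ‖(z : ℂ)‖)
      (comap (fun z : ℍ => ‖(z : ℂ)‖) atTop) (𝓝 0) :=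
    Tendsto.div_atTop tendsto_const_nhds tendsto_comap
  refine squeeze_zero (fun _ => norm_nonneg _) (fun z => ?_) hlim
  have hz : (z : ℂ) ≠ 0 := z.ne_zero
  rw [coe_sub hf, add_div, div_self hz, add_sub_cancel_left, norm_div, norm_mul,
    Complex.norm_exp_I_mul_ofReal, one_mul]
  have := h.norm_displacement_le hθ (dominated_conj_mul hφ z)
  gcongr

lemma differentiableAt_term {k : ℕ} {v : ℂ} (hv : v + c.γ k ∈ Complex.slitPlane) :
    DifferentiableAt ℂ (c.term k) v := by
  have h1 : DifferentiableAt ℂ (fun v : ℂ => (v + c.γ k) ^ (c.ε k : ℂ)) v :=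
    ((differentiableAt_id.add_const _).cpow (differentiableAt_const _) hv)
  refine DifferentiableAt.div (differentiableAt_const _) h1 ?_
  rw [Ne, Complex.cpow_eq_zero_iff]
  exact fun hz => Complex.slitPlane_ne_zero hv hz.1

lemma mdifferentiable (h : c.Admissible θ) (hθ : θ < π / 2)
    (hφ : φ ∈ Set.Ioo 0 π) (hf : c.IsConjugate φ f) : MDifferentiable 𝓘(ℂ) 𝓘(ℂ) f := by
  set ξ := Complex.exp (Complex.I * φ) with hξ
  have hU : IsOpen {v : ℂ | 0 < (ξ * v).im} :=
    isOpen_lt continuous_const (Complex.continuous_im.comp (continuous_const.mul continuous_id))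
  have hsin := Real.sin_pos_of_pos_of_lt_pi hφ.1 hφ.2
  have hdisp : DifferentiableOn ℂ c.displacement {v : ℂ | 0 < (ξ * v).im} := by
    refine Complex.differentiableOn_tsum_of_summable_norm (h.step_summable.mul_left (Real.sin φ)⁻¹)
      (fun k v hv => ?_) hU fun k v hv => ?_
    · refine (differentiableAt_term ?_).differentiableWithinAt
      rw [Complex.mem_slitPlane_iff]
      -- On the branch cut $v$ would be a negative real, and its rotation would have negative
      -- imaginary part.
      by_contra! hcon
      have hv : 0 < (ξ * v).im := hv
      rw [hξ, exp_I_mul_mul_im] at hv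
      simp only [Complex.add_re, Complex.add_im, Complex.ofReal_re, Complex.ofReal_im,
        add_zero] at hcon
      rw [hcon.2] at hv
      nlinarith [h.γ_pos (k + 1) k.succ_pos]
    · have := dominated_of_im_pos (c := c) hφ hv
      exact h.norm_term_le hθ k.succ_pos this.1 this.2.1 (this.2.2 _ k.succ_pos)
  have hF : DifferentiableOn ℂ (fun z : ℂ => ξ * c.F (starRingEnd ℂ ξ * z)) {z | 0 < z.im} := by
    have h1 : DifferentiableOn ℂ c.F {v : ℂ | 0 < (ξ * v).im} := differentiableOn_id.add hdisp
    refine (h1.comp (differentiableOn_id.const_mul _) fun z hz => ?_).const_mul _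
    change 0 < (ξ * (starRingEnd ℂ ξ * z)).im
    rw [hξ, exp_I_mul_mul_conj]
    exact hz
  have hcoe : MDifferentiable 𝓘(ℂ) 𝓘(ℂ) fun z : ℍ => (f z : ℂ) := by
    refine UpperHalfPlane.mdifferentiable_iff.2 (hF.congr fun z hz => ?_)
    have hz : 0 < z.im := hz
    simp only [Function.comp_apply, hf _, UpperHalfPlane.ofComplex_apply_of_im_pos hz]
    rfl
  intro z
  have h1 := (UpperHalfPlane.mdifferentiableAt_ofComplex (f z).im_pos).comp z (hcoe z)
  have h2 : (UpperHalfPlane.ofComplex : ℂ → ℍ) ∘ (fun z : ℍ => (f z : ℂ)) = f := by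
    funext z
    exact UpperHalfPlane.ofComplex_apply (f z)
  rwa [h2] at h1

/-- Imaginary parts never fall below $\operatorname{Im}z$, so the hyperbolic step is at most
$2\,\mathrm{arsinh}(\|d\|/(2\operatorname{Im}z))$ with $d$ the displacement, which tends to $0$. -/
lemma hasZeroHyperbolicStep (h : c.Admissible θ) (h0 : 0 < θ) (hθ : θ < π / 2)
    (hφ : φ ∈ Set.Icc θ (π - θ)) (hf : c.IsConjugate φ f) : HasZeroHyperbolicStep f := by
  intro z
  have hφ' : φ ∈ Set.Ioo 0 π := ⟨by linarith [hφ.1], by linarith [hφ.2]⟩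
  have hstep : ∀ z : ℍ, z.im ≤ (f z).im := fun z => by
    have hz : (0 : ℝ) < (Complex.exp (Complex.I * φ) *
        (starRingEnd ℂ (Complex.exp (Complex.I * φ)) * (z : ℂ))).im := by
      rw [exp_I_mul_mul_conj]
      exact z.im_pos
    have := h.exp_mul_F_im h0 hθ hφ hz
    rw [← hf z, exp_I_mul_mul_conj] at this
    exact this
  have him : ∀ n, z.im ≤ (f^[n] z).im := fun n => by
    induction n with
    | zero => exact le_rfl
    | succ n ih =>
      rw [Function.iterate_succ_apply']
      exact ih.trans (hstep _)
  have hdist : ∀ n, dist ((f^[n + 1] z : ℍ) : ℂ) ((f^[n] z : ℍ) : ℂ) = ‖c.displacement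
      (starRingEnd ℂ (Complex.exp (Complex.I * φ)) * ((f^[n] z : ℍ) : ℂ))‖ := fun n => by
    rw [Function.iterate_succ_apply', coe_sub hf, dist_eq_norm, add_sub_cancel_left, norm_mul,
      Complex.norm_exp_I_mul_ofReal, one_mul]
  have hlim := (tendsto_zero_iff_norm_tendsto_zero.1
    (h.tendsto_displacement h0 hθ (isOrbit hφ' hf z))).div_const (2 * z.im)
  rw [zero_div] at hlim
  have hq : Tendsto (fun n => dist ((f^[n + 1] z : ℍ) : ℂ) ((f^[n] z : ℍ) : ℂ) /
      (2 * √((f^[n + 1] z).im * (f^[n] z).im))) atTop (𝓝 0) := by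
    refine squeeze_zero (fun n => by positivity) (fun n => ?_) hlim
    rw [hdist]
    have hz := z.im_pos
    gcongr
    refine Real.le_sqrt_of_sq_le ?_
    rw [sq]
    exact mul_le_mul (him _) (him _) hz.le (hz.le.trans (him _))
  have := ((Real.continuous_arsinh.tendsto 0).comp hq).const_mul 2
  rw [Real.arsinh_zero, mul_zero] at this
  exact this.congr fun n => (UpperHalfPlane.dist_eq _ _).symm

lemma eventually_arg_eq (h : c.Admissible θ) (h0 : 0 < θ) (hθ : θ < π / 2)
    (hφ : φ ∈ Set.Ioo 0 π) (hf : c.IsConjugate φ f) (z : ℍ) {w : ℕ → ℂ}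
    (hw : w = fun n => starRingEnd ℂ (Complex.exp (Complex.I * φ)) * ((f^[n] z : ℍ) : ℂ)) :
    ∀ᶠ n in atTop, Complex.arg ((f^[n] z : ℍ) : ℂ) = φ + Real.arctan ((w n).im / (w n).re) := by
  have := h.tendsto_re h0 hθ (isOrbit hφ hf z)
  rw [hw]
  filter_upwards [this.eventually_gt_atTop 0] with n hn
  exact UpperHalfPlane.arg_eq_add_arctan _ hφ rfl hn

lemma tendsto_arg_firstExit (h : c.Admissible θ) (h0 : 0 < θ) (hθ : θ < π / 2)
    (hφ : φ ∈ Set.Ioo 0 π) (hf : c.IsConjugate φ f) (z : ℍ) {w : ℕ → ℂ}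
    (hw : w = fun n => starRingEnd ℂ (Complex.exp (Complex.I * φ)) * ((f^[n] z : ℍ) : ℂ))
    {ψ : ℕ → ℕ} (hψ : Tendsto ψ atTop atTop) {s : ℝ} (hs : ∀ k, side (ψ k) = s) :
    Tendsto (fun k => Complex.arg ((f^[c.firstExit w (ψ k)] z : ℍ) : ℂ)) atTop
      (𝓝 (φ + s * θ)) := by
  have horb : c.IsOrbit (Real.sin φ) w := hw ▸ isOrbit hφ hf z
  have h1 := h.tendsto_slope_firstExit h0 hθ horb hψ hs
  have h2 := ((Real.continuous_arctan.tendsto _).comp h1).const_add φ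
  have hpi := Real.pi_pos
  have h3 : Real.arctan (s * Real.tan θ) = s * θ := by
    have hθ' : Real.arctan (Real.tan θ) = θ := Real.arctan_tan (by linarith) hθ
    rcases side_eq (ψ 0) with e | e <;> rw [hs] at e <;> simp [e, hθ', Real.arctan_neg]
  rw [h3] at h2
  refine h2.congr' ?_
  have h4 := ((h.tendsto_firstExit h0 hθ horb).comp hψ).eventually
    (h.eventually_arg_eq h0 hθ hφ hf z hw)
  filter_upwards [h4] with k hk
  exact hk.symm

lemma tendsto_arg_even (h : c.Admissible θ) (h0 : 0 < θ) (hθ : θ < π / 2)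
    (hφ : φ ∈ Set.Ioo 0 π) (hf : c.IsConjugate φ f) (z : ℍ) {w : ℕ → ℂ}
    (hw : w = fun n => starRingEnd ℂ (Complex.exp (Complex.I * φ)) * ((f^[n] z : ℍ) : ℂ)) :
    Tendsto (fun k => Complex.arg ((f^[c.firstExit w (2 * k)] z : ℍ) : ℂ)) atTop
      (𝓝 (φ + θ)) := by
  simpa using h.tendsto_arg_firstExit h0 hθ hφ hf z hw (ψ := fun k => 2 * k) (s := 1)
    tendsto_two_mul (fun k => by simp [side])

lemma tendsto_arg_odd (h : c.Admissible θ) (h0 : 0 < θ) (hθ : θ < π / 2)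
    (hφ : φ ∈ Set.Ioo 0 π) (hf : c.IsConjugate φ f) (z : ℍ) {w : ℕ → ℂ}
    (hw : w = fun n => starRingEnd ℂ (Complex.exp (Complex.I * φ)) * ((f^[n] z : ℍ) : ℂ)) :
    Tendsto (fun k => Complex.arg ((f^[c.firstExit w (2 * k + 1)] z : ℍ) : ℂ)) atTop
      (𝓝 (φ - θ)) := by
  simpa [sub_eq_add_neg] using h.tendsto_arg_firstExit h0 hθ hφ hf z hw
    (ψ := fun k => 2 * k + 1) (s := -1)
    tendsto_two_mul_add_one (fun k => by simp [side])

lemma slopeSet_eq (h : c.Admissible θ) (h0 : 0 < θ) (hθ : θ < π / 2)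
    (hφ : φ ∈ Set.Icc θ (π - θ)) (hf : c.IsConjugate φ f) (z : ℍ) :
    slopeSet f z = Set.Icc (φ - θ) (φ + θ) := by
  have hφ' : φ ∈ Set.Ioo 0 π := ⟨by linarith [hφ.1], by linarith [hφ.2]⟩
  obtain ⟨w, hw⟩ : ∃ w : ℕ → ℂ, w = fun n =>
    starRingEnd ℂ (Complex.exp (Complex.I * φ)) * ((f^[n] z : ℍ) : ℂ) := ⟨_, rfl⟩
  have horb : c.IsOrbit (Real.sin φ) w := hw ▸ isOrbit hφ' hf z
  have harg := h.eventually_arg_eq h0 hθ hφ' hf z hw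
  have hre := h.tendsto_re h0 hθ horb
  have hpi := Real.pi_pos
  have hatan : Real.arctan (Real.tan θ) = θ := Real.arctan_tan (by linarith) hθ
  refine Set.Subset.antisymm ?_ ?_
  · rintro s ⟨-, σ, hσ, hlim⟩
    have hσ' := hσ.tendsto_atTop
    have hbd : Tendsto (fun n => Real.arctan
        (Real.tan θ + ‖w 0‖ / Real.cos θ / (w (σ n)).re)) atTop (𝓝 θ) := by
      have h1 : Tendsto (fun n => ‖w 0‖ / Real.cos θ / (w (σ n)).re) atTop (𝓝 0) :=
        Tendsto.div_atTop tendsto_const_nhds (hre.comp hσ')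
      have h2 := (Real.continuous_arctan.tendsto _).comp (h1.const_add (Real.tan θ))
      rw [add_zero, hatan] at h2
      exact h2
    have hboth : ∀ᶠ n in atTop, |Complex.arg ((f^[σ n] z : ℍ) : ℂ) - φ| ≤ Real.arctan
        (Real.tan θ + ‖w 0‖ / Real.cos θ / (w (σ n)).re) := by
      filter_upwards [hσ'.eventually harg, (hre.comp hσ').eventually_gt_atTop 0] with n hn hn'
      have := abs_le.1 (h.abs_slope_le h0 hθ horb hn')
      rw [hn, add_sub_cancel_left, abs_le, ← Real.arctan_neg]
      exact ⟨Real.arctan_strictMono.monotone this.1, Real.arctan_strictMono.monotone this.2⟩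
    have := abs_le.1 (le_of_tendsto_of_tendsto (hlim.sub_const φ).abs hbd hboth)
    exact ⟨by linarith, by linarith⟩
  · intro s hs
    refine ⟨⟨by linarith [hs.1, hφ.1], by linarith [hs.2, hφ.2]⟩, ?_⟩
    have hexit := h.tendsto_firstExit h0 hθ horb
    have hb : MapClusterPt (φ + θ) atTop fun n => Complex.arg ((f^[n] z : ℍ) : ℂ) :=
      MapClusterPt.of_comp (hexit.comp tendsto_two_mul)
        (h.tendsto_arg_even h0 hθ hφ' hf z hw).mapClusterPt
    have ha : MapClusterPt (φ - θ) atTop fun n => Complex.arg ((f^[n] z : ℍ) : ℂ) :=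
      MapClusterPt.of_comp (hexit.comp tendsto_two_mul_add_one)
        (h.tendsto_arg_odd h0 hθ hφ' hf z hw).mapClusterPt
    refine (mapClusterPt_of_mem_Icc ?_ ha hb hs).tendsto_subseq
    have hsub := (h.tendsto_slope_sub h0 hθ horb).abs
    rw [abs_zero] at hsub
    rw [tendsto_zero_iff_abs_tendsto_zero]
    refine squeeze_zero' (Eventually.of_forall fun _ => abs_nonneg _) ?_ hsub
    filter_upwards [harg, (tendsto_add_atTop_nat 1).eventually harg] with n hn hn'
    simp only [Function.comp_apply]
    rw [hn, hn', add_sub_add_left_eq_sub]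
    exact Real.abs_arctan_sub_le _ _

end Admissible

end SlopeCoeffs

/-! ### Assembly. -/

theorem theorem2p4 (a b : ℝ) (ha : 0 ≤ a) (hab : a < b) (hb : b ≤ π)
    (hne : Set.Icc a b ≠ Set.Icc 0 π) :
    (∃ c : SlopeCoeffs, c.Admissible ((b - a) / 2)) ∧
    ∀ c : SlopeCoeffs, c.Admissible ((b - a) / 2) →
      (∀ z : ℍ, Summable fun k : ℕ =>
        c.term (k + 1) (starRingEnd ℂ (slopeRotation a b) * (z : ℂ))) ∧
      ∃ f : ℍ → ℍ,
        (∀ z : ℍ, (f z : ℂ) =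
          slopeRotation a b * c.F (starRingEnd ℂ (slopeRotation a b) * (z : ℂ))) ∧
        IsParabolicInfty f ∧
        HasZeroHyperbolicStep f ∧
        (∀ z : ℍ, slopeSet f z = Set.Icc a b) ∧
        ∃ z₀ : ℍ, (z₀ : ℂ) = slopeRotation a b * ((c.γ 1 / 2 : ℝ) : ℂ) ∧
          (∀ k : ℕ, 1 ≤ k → ∃ n : ℕ,
            c.γ k ^ 2 < (starRingEnd ℂ (slopeRotation a b) * ((f^[n] z₀ : ℍ) : ℂ)).re) ∧
          StrictMonoOn (exitTime c (slopeRotation a b) f z₀) (Set.Ici 1) ∧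
          Tendsto (fun k : ℕ => Complex.arg
            ((f^[exitTime c (slopeRotation a b) f z₀ (2 * k)] z₀ : ℍ) : ℂ)) atTop (𝓝 b) ∧
          Tendsto (fun k : ℕ => Complex.arg
            ((f^[exitTime c (slopeRotation a b) f z₀ (2 * k + 1)] z₀ : ℍ) : ℂ)) atTop (𝓝 a) := by
  have h0 : 0 < (b - a) / 2 := by linarith
  have hθ : (b - a) / 2 < π / 2 := by
    by_contra! hcon
    obtain rfl : a = 0 := by linarith
    obtain rfl : b = π := by linarith
    exact hne rfl
  have hrot : slopeRotation a b = Complex.exp (Complex.I * ((a + (b - a) / 2 : ℝ) : ℂ)) := rfl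
  have ha' : a + (b - a) / 2 - (b - a) / 2 = a := by ring
  have hb' : a + (b - a) / 2 + (b - a) / 2 = b := by ring
  have hφ : a + (b - a) / 2 ∈ Set.Icc ((b - a) / 2) (π - (b - a) / 2) :=
    ⟨by linarith, by linarith⟩
  have hφ' : a + (b - a) / 2 ∈ Set.Ioo 0 π := ⟨by linarith, by linarith⟩
  rw [hrot]
  generalize a + (b - a) / 2 = φ at *
  generalize (b - a) / 2 = θ at *
  subst ha' hb'
  refine ⟨⟨_, SlopeCoeffs.explicit_admissible h0 hθ⟩, fun c h => ⟨fun z =>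
    h.summable_term hθ (SlopeCoeffs.Admissible.dominated_conj_mul hφ' z), ?_⟩⟩
  obtain ⟨f, hf⟩ := h.exists_selfMap h0 hθ hφ
  have hz₀ : 0 < (Complex.exp (Complex.I * φ) * ((c.γ 1 / 2 : ℝ) : ℂ)).im := by
    have := h.γ_one
    have hs := Real.sin_pos_of_pos_of_lt_pi hφ'.1 hφ'.2
    rw [exp_I_mul_mul_im, Complex.ofReal_re, Complex.ofReal_im, mul_zero, add_zero]
    positivity
  -- `exitTime` unfolds to `firstExit` of the rotated orbit. The special start $z_0$ matters only
  -- for strict monotonicity; the two limits hold from every point.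
  refine ⟨f, hf, ⟨h.mdifferentiable hθ hφ' hf, h.hasDenjoyWolffInfty h0 hθ hφ' hf,
    h.hasAngularLimitInfty hθ hφ' hf⟩, h.hasZeroHyperbolicStep h0 hθ hφ hf,
    h.slopeSet_eq h0 hθ hφ hf, ⟨_, hz₀⟩, rfl,
    fun k _ => h.exists_exit h0 hθ (SlopeCoeffs.Admissible.isOrbit hφ' hf _) k,
    h.strictMonoOn_firstExit h0 hθ (SlopeCoeffs.Admissible.isOrbit hφ' hf _)
      (conj_exp_I_mul_mul _ _),
    h.tendsto_arg_even h0 hθ hφ' hf _ rfl, h.tendsto_arg_odd h0 hθ hφ' hf _ rfl⟩
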